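/- Let $L>0$, $n_+>1$, $\rho>0$. Let $\mathcal A_{sym}$ be the set of measurable $n:\mathbb R\to\mathbb R$ with $1\le n\le n_+$ on $[0,L]$, $n=1$ outside $[0,L]$ and $n(L-x)=n(x)$. A pair $(\omega,u)$, $\omega\in\mathbb C$, is a scattering resonance pair of $n$ if $u\not\equiv0$ is a locally integrable function on $\mathbb R$ with $$u(x)=\omega^2\int_0^L G(|x-y|,\omega)\,[n^2(y)-1]\,u(y)\,dy\quad(x\in\mathbb R),\qquad G(r,\omega)=-\frac{e^{i\omega r}}{2i\omega},$$ and then $\omega$ is called a resonance of $n$ (there is no such pair with $\omega=0$). Put $\Gamma^\rho[n]=\inf|\Im\omega|$, the infimum over all resonances $\omega$ of $n$ with $|\Re\omega|\le\rho$ ($\infty$ if there are none). Let $n_\star\in\mathcal A_{sym}$ be a local minimizer of $\Gamma^\rho$ over $\mathcal A_{sym}$ with respect to the $L^\infty$ distance, and let $(\omega_\star,u_\star)$ be a scattering resonance pair of $n_\star$ with $|\Im\omega_\star|=\Gamma^\rho[n_\star]$ and $0<|\Re\omega_\star|<\rho$. Then $u_\star(0)\neq0$, and $n_\star$ is (almost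 everywhere) a step function: there are an odd $N$ and points $0\le x_0<x_1<\dots<x_N\le L$ such that $n_\star=n_+$ a.e. on $(x_j,x_{j+1})$ for even $j<N$ and $n_\star=1$ a.e. elsewhere. For any such representation and every interior interval $I_j=[x_j,x_{j+1}]$, that is, $0<j<N-1$ and $j\ne(N-1)/2$, the minimum of $|u_\star|^2$ on $I_j$ exists and $$|x_{j+1}-x_j|\ \ge\ \frac{\min_{x\in I_j}|u_\star(x)|^2}{|u_\star(0)|^2}\;\frac14\;\frac{2\pi}{|\Re\omega_\star|}.$$ -/

import Mathlib

open MeasureTheory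

namespace Resonance1D

noncomputable section

/-- Admissible refractive indices on `[0, L]` with material bounds `nm ≤ n ≤ np`, equal to `1`
outside `[0, L]` and symmetric about `L / 2`. -/
def AdmissibleSym (L nm np : ℝ) : Set (ℝ → ℝ) :=
  {n | Measurable n ∧ (∀ x ∈ Set.Icc 0 L, nm ≤ n x ∧ n x ≤ np) ∧
    (∀ x, x ∉ Set.Icc 0 L → n x = 1) ∧ ∀ x, n (L - x) = n x}

/-- The outgoing free-space Green's function in dimension one, as a function of `r = |x - y|`. -/
def green (ω : ℂ) (r : ℝ) : ℂ :=
  -(2 * Complex.I * ω)⁻¹ * Complex.exp (Complex.I * ω * r)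

/-- `(ω, u)` is a scattering resonance pair for the index `n` on `[0, L]`: `u` is a nontrivial
locally integrable solution of the integral equation
`u(x) = ω² ∫_{[0,L]} G(|x - y|, ω) (n(y)² - 1) u(y) dy`.
The equation is imposed for every `x`, which selects the continuous representative of `u`. -/
structure IsResonancePair (L : ℝ) (n : ℝ → ℝ) (ω : ℂ) (u : ℝ → ℂ) : Prop where
  locallyIntegrable : LocallyIntegrable u volume
  nontrivial : u ≠ 0
  eq : ∀ x, u x = ω ^ 2 *
    ∫ y in Set.Icc 0 L, green ω |x - y| * ((n y : ℂ) ^ 2 - 1) * u y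

/-- The scattering resonances `ω` of `n` with `|Re ω| ≤ ρ`. -/
def Res (L ρ : ℝ) (n : ℝ → ℝ) : Set ℂ :=
  {ω | (∃ u, IsResonancePair L n ω u) ∧ |ω.re| ≤ ρ}

/-- The minimal resonance width, the infimum of `|Im ω|` over `Res L ρ n`
(`∞` if there is no such resonance). -/
def width (L ρ : ℝ) (n : ℝ → ℝ) : ENNReal :=
  ⨅ ω ∈ Res L ρ n, ENNReal.ofReal |ω.im|

/-- `n` is a local minimizer of the minimal resonance width over the symmetric admissible
structures, with respect to the `L^∞` distance. -/
def IsLocalMinimizer (L nm np ρ : ℝ) (n : ℝ → ℝ) : Prop :=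
  n ∈ AdmissibleSym L nm np ∧ ∃ ε : ℝ, 0 < ε ∧ ∀ m ∈ AdmissibleSym L nm np,
    eLpNorm (fun x => m x - n x) ⊤ volume < ENNReal.ofReal ε → width L ρ n ≤ width L ρ m

open Classical in
/-- The step function equal to `np` on the intervals `(x_j, x_{j+1})` with `j < N` even and
equal to `1` elsewhere. -/
def stepIndex (np : ℝ) (N : ℕ) (x : ℕ → ℝ) (y : ℝ) : ℝ :=
  if ∃ j, j < N ∧ Even j ∧ y ∈ Set.Ioo (x j) (x (j + 1)) then np else 1

/-- `x_0 < x_1 < ⋯ < x_N` in `[0, L]` are the discontinuity points of the step function `n`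
(up to null sets), which equals `np` on `(x_j, x_{j+1})` for even `j` and `1` otherwise.
`N` is odd, since the last point `x_N` is the right end of an interval on which `n = np`.
Only the values `x j` with `j ≤ N` matter. -/
structure IsTransitionSeq (L np : ℝ) (n : ℝ → ℝ) (N : ℕ) (x : ℕ → ℝ) : Prop where
  odd : Odd N
  strictMono : StrictMonoOn x (Set.Iic N)
  mem : ∀ j ≤ N, x j ∈ Set.Icc 0 L
  ae_eq : n =ᵐ[volume] stepIndex np N x

/-- `[x_j, x_{j+1}]` is an interior interval: neither the left-most one (`j = 0`), nor the
right-most one (`j = N - 1`), nor the center one (`j = (N - 1) / 2`). -/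
def IsInterior (N j : ℕ) : Prop :=
  0 < j ∧ j + 1 < N ∧ 2 * j + 1 ≠ N

end

end Resonance1D

/-! The optimality of `n` enters only through a bang-bang principle; the length bound is then a
statement about how fast the phase of `u` can turn.

Bang-bang. On `[0, L]` the outgoing Green's operator is a rank-one term plus a Volterra operator.
The Volterra part is quasi-nilpotent, so the resonances `ω ≠ 0` are the zeros of a scalar function
`F (ω, t)`, smooth over `ℂ` in the frequency and in the parameter of the family `n² + t (n₁² - n²)`
(`exists_charFun`). At a resonance the `t`-derivative of `F` is, up to a nonzero factor, `∫ (n₁² -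
n²) u²` (`fderiv_charFun_mul`). Even for a zero of order `m`, some branch moves upward for small `t
> 0` if the leading coefficient lies in the upper half plane (`exists_zero_of_perturbation`). Since
`ω.im < 0`, moving up reduces the width. Let `n₁` be `np` where `G = Im (a u²) > 0` and `1`
elsewhere, for a suitable constant `a`; minimality then forces `∫ (n₁² - n²) G = 0`, although the
integrand is nonnegative, so `n = n₁` a.e. off the zeros of `G` (`exists_bangBang`). The competitor
is symmetric because `u` is even or odd about `L / 2`.

Step structure. With `b² = a`, `G = 2 Re (b u) Im (b u)`, and each factor has finitely many zeros in
`[0, L]` (`finite_im_eq_zero`). Hence `n` is a step function, and `G` vanishes at its inner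
transition points.

Length. The flux `J = Im (ū u')` equals `|u|²` times the phase velocity. It is strictly monotone on
`[0, L]`, runs from `-Re ω |u 0|²` to `Re ω |u 0|²`, and vanishes only at `L / 2`. Away from the
center the phase therefore turns in one direction, and between two zeros of `G` it turns by at least
`π / 2`. As its speed is at most `|Re ω| |u 0|² / min |u|²`, the bound follows
(`pi_div_two_mul_le`). -/

namespace Resonance1D

open Set Filter Topology

/-! ### Calculus of indefinite integrals: `n` is only measurable, so `u''` exists only a.e. -/

/-- `F` is an indefinite integral of the locally integrable function `f`. -/
structure IsPrimitive (F f : ℝ → ℂ) : Prop where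
  locallyIntegrable : LocallyIntegrable f volume
  sub_eq : ∀ a b, F b - F a = ∫ x in a..b, f x

theorem locallyIntegrable_mul_continuous {f g : ℝ → ℂ} (hf : LocallyIntegrable f volume)
    (hg : Continuous g) : LocallyIntegrable (fun x => f x * g x) volume := by
  rw [← locallyIntegrableOn_univ] at hf ⊢
  exact hf.mul_continuousOn hg.continuousOn isOpen_univ.isLocallyClosed

theorem locallyIntegrable_intervalIntegrable {f : ℝ → ℂ} (hf : LocallyIntegrable f volume)
    (a b : ℝ) : IntervalIntegrable f volume a b :=
  intervalIntegrable_iff.mpr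
    ((hf.integrableOn_isCompact isCompact_uIcc).mono_set uIoc_subset_uIcc)

namespace IsPrimitive

variable {F G f g : ℝ → ℂ}

theorem intervalIntegrable (h : IsPrimitive F f) (a b : ℝ) : IntervalIntegrable f volume a b :=
  locallyIntegrable_intervalIntegrable h.locallyIntegrable a b

theorem eq_add (h : IsPrimitive F f) (a x : ℝ) : F x = F a + ∫ y in a..x, f y := by
  rw [← h.sub_eq a x]; ring

theorem continuous (h : IsPrimitive F f) : Continuous F := by
  rw [show F = fun x => F 0 + ∫ y in (0 : ℝ)..x, f y from funext (h.eq_add 0)]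
  exact continuous_const.add (intervalIntegral.continuous_primitive h.intervalIntegrable 0)

theorem ae_hasDerivAt (h : IsPrimitive F f) : ∀ᵐ x, HasDerivAt F (f x) x := by
  filter_upwards [LocallyIntegrable.ae_hasDerivAt_integral h.locallyIntegrable] with x hx
  rw [show F = fun x => F 0 + ∫ y in (0 : ℝ)..x, f y from funext (h.eq_add 0)]
  exact (hx 0).const_add _

theorem hasDerivAt (h : IsPrimitive F f) (hf : Continuous f) (x : ℝ) : HasDerivAt F (f x) x := by
  rw [show F = fun x => F 0 + ∫ y in (0 : ℝ)..x, f y from funext (h.eq_add 0)]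
  exact (intervalIntegral.integral_hasDerivAt_right (h.intervalIntegrable 0 x)
    hf.aestronglyMeasurable.stronglyMeasurableAtFilter hf.continuousAt).const_add _

theorem of_hasDerivAt (h : ∀ x, HasDerivAt F (f x) x) (hf : Continuous f) : IsPrimitive F f :=
  ⟨hf.locallyIntegrable, fun a b => (intervalIntegral.integral_eq_sub_of_hasDerivAt
    (fun x _ => h x) (hf.intervalIntegrable a b)).symm⟩

theorem integral (hf : LocallyIntegrable f volume) (c : ℝ) :
    IsPrimitive (fun x => ∫ y in c..x, f y) f :=
  ⟨hf, fun a b => intervalIntegral.integral_interval_sub_left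
    (locallyIntegrable_intervalIntegrable hf c b) (locallyIntegrable_intervalIntegrable hf c a)⟩

theorem congr (h : IsPrimitive F f) (hF : ∀ x, F x = G x) (hf : ∀ x, f x = g x) :
    IsPrimitive G g := by
  rwa [← funext hF, ← funext hf]

theorem add (hF : IsPrimitive F f) (hG : IsPrimitive G g) :
    IsPrimitive (fun x => F x + G x) (fun x => f x + g x) :=
  ⟨hF.locallyIntegrable.add hG.locallyIntegrable, fun a b => by
    rw [intervalIntegral.integral_add (hF.intervalIntegrable a b) (hG.intervalIntegrable a b),
      ← hF.sub_eq, ← hG.sub_eq]; ring⟩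

theorem const_mul (hF : IsPrimitive F f) (c : ℂ) :
    IsPrimitive (fun x => c * F x) (fun x => c * f x) :=
  ⟨hF.locallyIntegrable.smul c, fun a b => by
    rw [intervalIntegral.integral_const_mul, ← hF.sub_eq]; ring⟩

theorem add_const (hF : IsPrimitive F f) (c : ℂ) : IsPrimitive (fun x => F x + c) f :=
  ⟨hF.locallyIntegrable, fun a b => by rw [← hF.sub_eq]; ring⟩

theorem conj (hF : IsPrimitive F f) :
    IsPrimitive (fun x => starRingEnd ℂ (F x)) (fun x => starRingEnd ℂ (f x)) := by
  refine ⟨?_, fun a b => ?_⟩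
  · refine hF.locallyIntegrable.mono
      (Complex.continuous_conj.comp_aestronglyMeasurable hF.locallyIntegrable.aestronglyMeasurable)
      (Eventually.of_forall fun x => by simp)
  · rw [← map_sub, hF.sub_eq]
    simp only [intervalIntegral, map_sub, integral_conj]

/-- Increments of `F` are dominated by those of the indefinite integral of `‖f‖`, which is
absolutely continuous. -/
theorem absolutelyContinuousOnInterval (h : IsPrimitive F f) (a b : ℝ) :
    AbsolutelyContinuousOnInterval F a b := by
  have hn := (h.intervalIntegrable a b).norm.absolutelyContinuousOnInterval_intervalIntegral
    (c := a) left_mem_uIcc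
  rw [absolutelyContinuousOnInterval_iff] at hn ⊢
  intro ε hε
  obtain ⟨δ, hδ, H⟩ := hn ε hε
  refine ⟨δ, hδ, fun E hE hlt => lt_of_le_of_lt (Finset.sum_le_sum fun i _ => ?_) (H E hE hlt)⟩
  have hi : ∀ c d, IntervalIntegrable (fun x => ‖f x‖) volume c d :=
    fun c d => (h.intervalIntegrable c d).norm
  rw [dist_comm, dist_comm (∫ v in a..(E.2 i).1, ‖f v‖), dist_eq_norm, h.sub_eq, Real.dist_eq,
    intervalIntegral.integral_interval_sub_left (hi _ _) (hi _ _)]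
  exact intervalIntegral.norm_integral_le_abs_integral_norm

/-- The difference of `F G` and the indefinite integral of `f G + F g` is absolutely continuous with
a.e. zero derivative, hence constant. -/
theorem mul (hF : IsPrimitive F f) (hG : IsPrimitive G g) :
    IsPrimitive (fun x => F x * G x) (fun x => f x * G x + F x * g x) := by
  have hl : LocallyIntegrable (fun x => f x * G x + F x * g x) volume :=
    (locallyIntegrable_mul_continuous hF.locallyIntegrable hG.continuous).add
      ((locallyIntegrable_mul_continuous hG.locallyIntegrable hF.continuous).congr
        (Eventually.of_forall fun x => mul_comm _ _))
  have hP := IsPrimitive.integral hl 0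
  refine ⟨hl, fun a b => ?_⟩
  have hac := ((hF.absolutelyContinuousOnInterval a b).smul
    (hG.absolutelyContinuousOnInterval a b)).sub (hP.absolutelyContinuousOnInterval a b)
  obtain ⟨C, hC⟩ := hac.const_of_ae_hasDerivAt_zero (by
    filter_upwards [hF.ae_hasDerivAt, hG.ae_hasDerivAt, hP.ae_hasDerivAt] with x h1 h2 h3 _
    have := (h1.mul h2).sub h3
    rw [sub_self] at this
    exact this)
  have ha := hC a left_mem_uIcc
  have hb := hC b right_mem_uIcc
  simp only [Pi.sub_apply, smul_eq_mul, Pi.mul_apply] at ha hb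
  rw [← hP.sub_eq]
  linear_combination hb - ha

end IsPrimitive

theorem isPrimitive_cexp (c : ℂ) :
    IsPrimitive (fun x : ℝ => Complex.exp (c * x)) (fun x : ℝ => c * Complex.exp (c * x)) := by
  refine IsPrimitive.of_hasDerivAt (fun x => ?_) (by fun_prop)
  have h1 : HasDerivAt (fun x : ℝ => c * (x : ℂ)) c x := by
    simpa using (Complex.ofRealCLM.hasDerivAt (x := x)).const_mul c
  simpa [mul_comm] using h1.cexp

theorem isPrimitive_integral_Iic {f : ℝ → ℂ} (hf : Integrable f) :
    IsPrimitive (fun x => ∫ y in Iic x, f y) f :=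
  ⟨hf.locallyIntegrable, fun _ _ =>
    intervalIntegral.integral_Iic_sub_Iic hf.integrableOn hf.integrableOn⟩

/-- The exceptional point `c` absorbs the single point in which the half line `Iic 0` meets `[0,
L]`. -/
theorem setIntegral_eq_zero_of_ae {f : ℝ → ℂ} {L : ℝ} (hsupp : ∀ x ∉ Icc 0 L, f x = 0)
    {s : Set ℝ} {c : ℝ} (hs : MeasurableSet s) (hsc : ∀ x ∈ s, x ≠ c → x ∉ Icc 0 L) :
    ∫ x in s, f x = 0 := by
  refine (setIntegral_congr_ae (g := fun _ => 0) hs ?_).trans (by simp)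
  filter_upwards [compl_mem_ae_iff.2 (measure_singleton (μ := volume) c)] with x hx hxs
  exact hsupp x (hsc x hxs hx)

/-! ### From the integral equation to the Helmholtz equation -/

/-- A function given by the outgoing Green's function applied to a source `f` supported in
`[0, L]` solves `u'' = -ω² (u + f)` with outgoing boundary conditions. -/
theorem exists_deriv_of_green {L : ℝ} {ω : ℂ} {f u : ℝ → ℂ} (hω : ω ≠ 0)
    (hf : LocallyIntegrable f volume) (hsupp : ∀ x ∉ Icc 0 L, f x = 0)
    (hu : ∀ x, u x = ω ^ 2 * ∫ y in Icc 0 L, green ω |x - y| * f y) :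
    ∃ w, IsPrimitive u w ∧ IsPrimitive w (fun x => -ω ^ 2 * (u x + f x)) ∧
      w 0 = -(Complex.I * ω) * u 0 ∧ w L = Complex.I * ω * u L := by
  have hint : ∀ {g : ℝ → ℂ}, Continuous g → Integrable (fun x => f x * g x) := fun {g} hg => by
    have h1 : IntegrableOn (fun x => f x * g x) (Icc 0 L) :=
      (locallyIntegrable_mul_continuous hf hg).integrableOn_isCompact isCompact_Icc
    rwa [integrableOn_iff_integrable_of_support_subset] at h1
    intro x hx
    by_contra hx'
    simp [hsupp x hx'] at hx
  have hp : Integrable (fun y : ℝ => f y * Complex.exp (Complex.I * ω * y)) :=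
    hint (g := fun y : ℝ => Complex.exp (Complex.I * ω * y)) (by fun_prop)
  have hm : Integrable (fun y : ℝ => f y * Complex.exp (-(Complex.I * ω) * y)) :=
    hint (g := fun y : ℝ => Complex.exp (-(Complex.I * ω) * y)) (by fun_prop)
  -- Cutting the kernel at `y = x` leaves a right-moving wave with amplitude `A` (sources left of
  -- `x`) and a left-moving one with amplitude `B` (sources right of `x`). `B` is written as the
  -- total minus an integral over `Iic x`, so that it is visibly a primitive.
  have hA := isPrimitive_integral_Iic hm
  have hB := ((isPrimitive_integral_Iic hp).const_mul (-1)).add_const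
    (∫ y : ℝ, f y * Complex.exp (Complex.I * ω * y))
  set A : ℝ → ℂ := fun x => ∫ y in Iic x, f y * Complex.exp (-(Complex.I * ω) * y) with hAdef
  set B : ℝ → ℂ := fun x => -1 * (∫ y in Iic x, f y * Complex.exp (Complex.I * ω * y)) +
    ∫ y : ℝ, f y * Complex.exp (Complex.I * ω * y) with hBdef
  have hB' : ∀ x, B x = ∫ y in Ioi x, f y * Complex.exp (Complex.I * ω * y) := fun x => by
    have h := integral_add_compl (measurableSet_Iic (a := x)) hp
    rw [compl_Iic] at h
    simp only [hBdef]
    rw [← h]; ring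
  have hform : ∀ x : ℝ, Complex.I * ω / 2 * (Complex.exp (Complex.I * ω * x) * A x +
      Complex.exp (-(Complex.I * ω) * x) * B x) = u x := fun x => by
    have h0 : ∫ y in Icc 0 L, green ω |x - y| * f y = ∫ y, green ω |x - y| * f y :=
      setIntegral_eq_integral_of_forall_compl_eq_zero fun y hy => by rw [hsupp y hy, mul_zero]
    have hg : Integrable (fun y => green ω |x - y| * f y) := by
      refine (hint (g := fun y => green ω |x - y|) ?_).congr
        (Eventually.of_forall fun y => mul_comm _ _)
      unfold green
      fun_prop
    have h1 := integral_add_compl (measurableSet_Iic (a := x)) hg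
    rw [compl_Iic] at h1
    have h2 : ∫ y in Iic x, green ω |x - y| * f y =
        -(2 * Complex.I * ω)⁻¹ * Complex.exp (Complex.I * ω * x) * A x := by
      rw [hAdef, ← integral_const_mul]
      refine setIntegral_congr_fun measurableSet_Iic fun y hy => ?_
      have : |x - y| = x - y := abs_of_nonneg (sub_nonneg.2 hy)
      simp only [green, this]
      have he : Complex.exp (Complex.I * ω * ((x - y : ℝ) : ℂ)) =
          Complex.exp (Complex.I * ω * x) * Complex.exp (-(Complex.I * ω) * y) := by
        rw [← Complex.exp_add]; congr 1; push_cast; ring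
      rw [he]; ring
    have h3 : ∫ y in Ioi x, green ω |x - y| * f y =
        -(2 * Complex.I * ω)⁻¹ * Complex.exp (-(Complex.I * ω) * x) * B x := by
      rw [hB', ← integral_const_mul]
      refine setIntegral_congr_fun measurableSet_Ioi fun y hy => ?_
      have : |x - y| = y - x := by
        rw [abs_sub_comm]; exact abs_of_nonneg (sub_nonneg.2 (le_of_lt hy))
      simp only [green, this]
      have he : Complex.exp (Complex.I * ω * ((y - x : ℝ) : ℂ)) =
          Complex.exp (-(Complex.I * ω) * x) * Complex.exp (Complex.I * ω * y) := by
        rw [← Complex.exp_add]; congr 1; push_cast; ring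
      rw [he]; ring
    rw [hu x, h0, ← h1, h2, h3]
    have hI : (2 * Complex.I * ω)⁻¹ = -Complex.I / (2 * ω) := by
      rw [mul_inv, mul_inv, Complex.inv_I]; field_simp
    rw [hI]
    field_simp
  have hA0 : A 0 = 0 :=
    setIntegral_eq_zero_of_ae (L := L) (c := 0) (fun x hx => by simp [hsupp x hx])
      measurableSet_Iic fun x hx hx0 h => hx0 (le_antisymm hx h.1)
  have hBL : B L = 0 := by
    rw [hB']
    exact setIntegral_eq_zero_of_ae (L := L) (c := L) (fun x hx => by simp [hsupp x hx])
      measurableSet_Ioi fun x hx _ h => not_lt_of_ge h.2 hx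
  clear_value A B
  have hexp : ∀ x : ℝ, Complex.exp (Complex.I * ω * x) * Complex.exp (-(Complex.I * ω) * x) = 1 :=
    fun x => by rw [← Complex.exp_add]; simp
  have h1 := (isPrimitive_cexp (Complex.I * ω)).mul hA
  have h2 := (isPrimitive_cexp (-(Complex.I * ω))).mul hB
  -- Variation of constants: in the derivative of `hform` the terms with `A'` and `B'` cancel, which
  -- leaves this `w`. The outgoing conditions are `A 0 = 0` and `B L = 0`.
  refine ⟨fun x => -ω ^ 2 / 2 * (Complex.exp (Complex.I * ω * x) * A x +
    -1 * (Complex.exp (-(Complex.I * ω) * x) * B x)), ?_, ?_, ?_, ?_⟩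
  · refine ((h1.add h2).const_mul (Complex.I * ω / 2)).congr hform fun x => ?_
    linear_combination (ω ^ 2 / 2 * (Complex.exp (Complex.I * ω * x) * A x -
      (Complex.exp (-(Complex.I * ω) * x) * B x))) * Complex.I_sq
  · refine ((h1.add (h2.const_mul (-1))).const_mul (-ω ^ 2 / 2)).congr (fun _ => rfl) fun x => ?_
    linear_combination -ω ^ 2 * hform x - ω ^ 2 * f x * hexp x
  · have := hform 0
    simp only [hA0] at this ⊢
    linear_combination -(Complex.I * ω) * this +
      (ω ^ 2 / 2 * (Complex.exp (-(Complex.I * ω) * (0 : ℝ)) * B 0)) * Complex.I_sq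
  · have := hform L
    simp only [hBL] at this ⊢
    linear_combination (Complex.I * ω) * this +
      (-ω ^ 2 / 2 * (Complex.exp ((Complex.I * ω) * L) * A L)) * Complex.I_sq

/-! ### Volterra operators on `C([0, L])` and the characteristic function -/

theorem intervalIntegrable_of_bounded {V : ℝ → ℂ} {M : ℝ} (hV : Measurable V)
    (hM : ∀ x, ‖V x‖ ≤ M) {v : ℝ → ℂ} (hv : Continuous v) (a b : ℝ) :
    IntervalIntegrable (fun y => V y * v y) volume a b := by
  refine ((hv.norm.const_mul M).intervalIntegrable a b).mono_fun
    (hV.aestronglyMeasurable.mul hv.aestronglyMeasurable) (Eventually.of_forall fun y => ?_)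
  change ‖V y * v y‖ ≤ ‖M * ‖v y‖‖
  rw [norm_mul, Real.norm_eq_abs]
  exact (mul_le_mul_of_nonneg_right (hM y) (norm_nonneg _)).trans (le_abs_self _)

theorem continuous_IccExtend {L : ℝ} (hL : 0 ≤ L) (v : C(Icc 0 L, ℂ)) :
    Continuous (IccExtend hL v) := v.continuous.Icc_extend'

/-- The operator `v ↦ ∫₀ˣ V v` on continuous functions on `[0, L]`. -/
theorem exists_primitiveOp {L : ℝ} (hL : 0 ≤ L) {V : ℝ → ℂ} {M : ℝ} (hV : Measurable V)
    (hM : ∀ x, ‖V x‖ ≤ M) :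
    ∃ S : C(Icc 0 L, ℂ) →L[ℂ] C(Icc 0 L, ℂ), ∀ v x,
      S v x = ∫ y in (0 : ℝ)..x, V y * IccExtend hL v y := by
  have hi : ∀ v : C(Icc 0 L, ℂ), ∀ a b,
      IntervalIntegrable (fun y => V y * IccExtend hL v y) volume a b := fun v a b =>
    intervalIntegrable_of_bounded hV hM (continuous_IccExtend hL v) a b
  let S₀ : C(Icc 0 L, ℂ) →ₗ[ℂ] C(Icc 0 L, ℂ) :=
    { toFun := fun v => ⟨fun x => ∫ y in (0 : ℝ)..x, V y * IccExtend hL v y,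
        (intervalIntegral.continuous_primitive (hi v) 0).comp continuous_subtype_val⟩
      map_add' := fun v w => by
        ext x
        simp only [ContinuousMap.coe_mk, ContinuousMap.add_apply]
        rw [← intervalIntegral.integral_add (hi v _ _) (hi w _ _)]
        refine intervalIntegral.integral_congr fun y _ => ?_
        simp only [IccExtend, Function.comp, ContinuousMap.add_apply]; ring
      map_smul' := fun c v => by
        ext x
        simp only [ContinuousMap.coe_mk, ContinuousMap.smul_apply, RingHom.id_apply, smul_eq_mul]
        rw [← intervalIntegral.integral_const_mul]
        refine intervalIntegral.integral_congr fun y _ => ?_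
        simp only [IccExtend, Function.comp, ContinuousMap.smul_apply, smul_eq_mul]; ring }
  have hM0 : 0 ≤ M := (norm_nonneg _).trans (hM 0)
  refine ⟨S₀.mkContinuous (M * L) fun v => ?_, fun v x => rfl⟩
  refine (ContinuousMap.norm_le _ (by positivity)).2 fun x => ?_
  change ‖∫ y in (0 : ℝ)..x, V y * IccExtend hL v y‖ ≤ _
  have hb : ∀ y ∈ uIoc (0 : ℝ) x, ‖V y * IccExtend hL v y‖ ≤ M * ‖v‖ := fun y _ => by
    rw [norm_mul]
    exact mul_le_mul (hM y) (v.norm_coe_le_norm _) (norm_nonneg _) hM0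
  refine (intervalIntegral.norm_integral_le_of_norm_le_const hb).trans ?_
  rw [sub_zero, abs_of_nonneg x.2.1, mul_right_comm]
  exact mul_le_mul_of_nonneg_right (mul_le_mul_of_nonneg_left x.2.2 hM0) (norm_nonneg _)

/-- The product `(1 - K)(1 + K + ⋯ + K ^ (k - 1)) = 1 - K ^ k` is a unit by the Neumann series, and
commuting factors of a unit are units. -/
theorem isUnit_one_sub_of_norm_pow_lt_one {R : Type*} [NormedRing R] [HasSummableGeomSeries R]
    {K : R} {k : ℕ} (hk : ‖K ^ k‖ < 1) : IsUnit (1 - K) := by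
  have h1 : IsUnit ((1 - K) * ∑ i ∈ Finset.range k, K ^ i) := by
    rw [mul_neg_geom_sum]
    exact isUnit_one_sub_of_norm_lt_one hk
  have hcomm : Commute (1 - K) (∑ i ∈ Finset.range k, K ^ i) := by
    refine Commute.sum_right _ _ _ fun i _ => ?_
    exact ((Commute.one_left K).sub_left (Commute.refl K)).pow_right i
  exact (hcomm.isUnit_mul_iff.1 h1).1

/-- An operator of Volterra type is quasi-nilpotent: `1 - K` is invertible. -/
theorem isUnit_one_sub_of_volterra {L : ℝ} (hL : 0 ≤ L)
    (K : C(Icc 0 L, ℂ) →L[ℂ] C(Icc 0 L, ℂ)) {c : ℝ} (hc : 0 ≤ c)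
    (hK : ∀ v x, ‖K v x‖ ≤ c * ∫ y in (0 : ℝ)..x, ‖IccExtend hL v y‖) : IsUnit (1 - K) := by
  -- Iterating the bound integrates `y ^ k` at each step; the resulting factorial makes some power
  -- of `K` a contraction, whatever the size of `c`.
  have hpow : ∀ k : ℕ, ∀ v x, ‖(K ^ k) v x‖ ≤ c ^ k * (x : ℝ) ^ k / k.factorial * ‖v‖ := by
    intro k
    induction k with
    | zero => intro v x; simpa using v.norm_coe_le_norm x
    | succ k ih =>
      intro v x
      rw [pow_succ', mul_apply_eq_comp]
      refine (hK _ x).trans ?_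
      have h1 : ∫ y in (0 : ℝ)..x, ‖IccExtend hL ((K ^ k) v) y‖ ≤
          ∫ y in (0 : ℝ)..x, c ^ k / k.factorial * ‖v‖ * y ^ k := by
        refine intervalIntegral.integral_mono_on x.2.1
          ((continuous_IccExtend hL _).norm.intervalIntegrable _ _)
          (Continuous.intervalIntegrable (by fun_prop) _ _) fun y hy => ?_
        have hyL : y ∈ Icc 0 L := ⟨hy.1, hy.2.trans x.2.2⟩
        rw [IccExtend_of_mem hL _ hyL]
        refine (ih v ⟨y, hyL⟩).trans (le_of_eq ?_)
        ring
      rw [intervalIntegral.integral_const_mul, integral_pow] at h1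
      refine (mul_le_mul_of_nonneg_left h1 hc).trans (le_of_eq ?_)
      rw [Nat.factorial_succ]
      push_cast
      field_simp
      simp [pow_succ']
      ring
  have hlim := FloorSemiring.tendsto_pow_div_factorial_atTop (c * L)
  obtain ⟨k, hk⟩ := (hlim.eventually_lt_const zero_lt_one).exists
  have hnorm : ‖K ^ k‖ < 1 := by
    refine lt_of_le_of_lt (ContinuousLinearMap.opNorm_le_bound _ (by positivity) fun v => ?_) hk
    refine (ContinuousMap.norm_le _ (by positivity)).2 fun x => (hpow k v x).trans ?_
    rw [mul_pow]
    have := x.2.1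
    have := x.2.2
    gcongr
  exact isUnit_one_sub_of_norm_pow_lt_one (R := C(Icc 0 L, ℂ) →L[ℂ] C(Icc 0 L, ℂ)) (k := k) hnorm

/-- The wave `e^{iωx}` is an exponential in the Banach algebra `C([0, L])`, where `exp` is analytic;
this gives smooth dependence on `ω` in the sup norm. -/
theorem contDiff_exp_continuousMap {L : ℝ} (i : C(Icc 0 L, ℂ)) (c : ℂ) :
    ContDiff ℂ 1 (fun p : ℂ × ℂ => NormedSpace.exp ((c * p.1) • i)) := by
  rw [contDiff_iff_contDiffAt]
  intro p
  have h : ContDiffAt ℂ 1 NormedSpace.exp ((c * p.1) • i) :=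
    (NormedSpace.exp_analytic ((c * p.1) • i)).contDiffAt
  exact h.comp p (f := fun p : ℂ × ℂ => (c * p.1) • i) (by fun_prop)

theorem exp_continuousMap_apply {L : ℝ} (f : C(Icc 0 L, ℂ)) (x : Icc 0 L) :
    (NormedSpace.exp f) x = Complex.exp (f x) := by
  let _ : NormedAlgebra ℚ C(Icc 0 L, ℂ) := NormedAlgebra.restrictScalars ℚ ℝ _
  have := NormedSpace.map_exp (ContinuousMap.evalAlgHom ℂ ℂ x)
    (continuous_eval_const x) f
  rw [Complex.exp_eq_exp_ℂ]
  exact this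

noncomputable section

/-- The Volterra part `(iω/2) ∫₀ˣ (e^{iω(x-y)} - e^{-iω(x-y)}) W(y) ψ(y) dy` of the outgoing
Green's operator. -/
def volterra (ω : ℂ) (W ψ : ℝ → ℂ) (x : ℝ) : ℂ :=
  Complex.I * ω / 2 *
    (Complex.exp (Complex.I * ω * x) *
        (∫ y in (0 : ℝ)..x, W y * (Complex.exp (-(Complex.I * ω) * y) * ψ y)) -
      Complex.exp (-(Complex.I * ω) * x) *
        ∫ y in (0 : ℝ)..x, W y * (Complex.exp (Complex.I * ω * y) * ψ y))

/-- The amplitude `(iω/2) ∫₀ᴸ e^{iωy} W(y) ψ(y) dy` of the wave emitted to the left. -/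
def amplitude (L : ℝ) (ω : ℂ) (W ψ : ℝ → ℂ) : ℂ :=
  Complex.I * ω / 2 * ∫ y in (0 : ℝ)..L, W y * (Complex.exp (Complex.I * ω * y) * ψ y)

end

theorem volterra_congr (ω : ℂ) (W : ℝ → ℂ) {ψ ψ' : ℝ → ℂ} {x : ℝ}
    (h : ∀ z ∈ uIcc 0 x, ψ z = ψ' z) : volterra ω W ψ x = volterra ω W ψ' x := by
  have h1 : ∀ g : ℝ → ℂ, ∫ y in (0 : ℝ)..x, W y * (g y * ψ y) =
      ∫ y in (0 : ℝ)..x, W y * (g y * ψ' y) := fun g =>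
    intervalIntegral.integral_congr fun z hz => by simp only [h z hz]
  simp only [volterra]
  rw [h1 fun y : ℝ => Complex.exp (-(Complex.I * ω) * y),
    h1 fun y : ℝ => Complex.exp (Complex.I * ω * y)]

theorem contDiff_smul_of {E : Type*} [NormedAddCommGroup E] [NormedSpace ℂ E] {a : ℂ × ℂ → ℂ}
    {f : ℂ × ℂ → E} (ha : ContDiff ℂ 1 a) (hf : ContDiff ℂ 1 f) :
    ContDiff ℂ 1 (fun p => a p • f p) := ha.smul hf

theorem contDiff_mulLeft {A : Type*} [NormedRing A] [NormedAlgebra ℂ A] {e : ℂ × ℂ → A}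
    (he : ContDiff ℂ 1 e) : ContDiff ℂ 1 (fun p => ContinuousLinearMap.mul ℂ A (e p)) :=
  (ContinuousLinearMap.mul ℂ A).contDiff.comp he

theorem contDiff_inverse_one_sub {R : Type*} [NormedRing R] [NormedAlgebra ℂ R]
    [HasSummableGeomSeries R] {T : ℂ × ℂ → R} (hT : ContDiff ℂ 1 T)
    (hunit : ∀ p, IsUnit (1 - T p)) : ContDiff ℂ 1 (fun p => Ring.inverse (1 - T p)) := by
  rw [contDiff_iff_contDiffAt]
  intro p
  obtain ⟨y, hy⟩ := hunit p
  have h1 := contDiffAt_ringInverse (n := 1) ℂ y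
  rw [hy] at h1
  exact h1.comp p (f := fun p => 1 - T p) (contDiff_const.sub hT).contDiffAt

/-- Solutions of the Volterra equations for the coefficients `V + tδ`, and their characteristic
function, as smooth functions of `(ω, t)`. -/
theorem exists_charFun {L : ℝ} (hL : 0 ≤ L) {V δ : ℝ → ℂ} {M : ℝ} (hV : Measurable V)
    (hVM : ∀ x, ‖V x‖ ≤ M) (hδ : Measurable δ) (hδM : ∀ x, ‖δ x‖ ≤ M) :
    ∃ (φ : ℂ × ℂ → C(Icc 0 L, ℂ)) (F : ℂ × ℂ → ℂ), ContDiff ℂ 1 F ∧ Continuous φ ∧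
      (∀ ω t, F (ω, t) = 1 - amplitude L ω (fun y => V y + t * δ y) (IccExtend hL (φ (ω, t)))) ∧
      (∀ ω t, ∀ x ∈ Icc 0 L, IccExtend hL (φ (ω, t)) x = Complex.exp (-(Complex.I * ω) * x) +
        volterra ω (fun y => V y + t * δ y) (IccExtend hL (φ (ω, t))) x) ∧
      ∀ ω t c, ∀ ψ : ℝ → ℂ, Continuous ψ →
        (∀ x ∈ Icc 0 L, ψ x = c * Complex.exp (-(Complex.I * ω) * x) +
          volterra ω (fun y => V y + t * δ y) ψ x) →
        ∀ x ∈ Icc 0 L, ψ x = c * IccExtend hL (φ (ω, t)) x := by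
  obtain ⟨S₀, hS₀⟩ := exists_primitiveOp hL hV hVM
  obtain ⟨S₁, hS₁⟩ := exists_primitiveOp hL hδ hδM
  have hM : 0 ≤ M := (norm_nonneg _).trans (hVM 0)
  let i : C(Icc 0 L, ℂ) := ⟨fun x => ((x : ℝ) : ℂ), by fun_prop⟩
  let e : ℂ × ℂ → C(Icc 0 L, ℂ) := fun p => NormedSpace.exp ((Complex.I * p.1) • i)
  let e' : ℂ × ℂ → C(Icc 0 L, ℂ) := fun p => NormedSpace.exp ((-Complex.I * p.1) • i)
  have he : ContDiff ℂ 1 e := contDiff_exp_continuousMap i _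
  have he' : ContDiff ℂ 1 e' := contDiff_exp_continuousMap i _
  have hea : ∀ ω t x, e (ω, t) x = Complex.exp (Complex.I * ω * (x : ℝ)) := fun ω t x => by
    simp only [e, exp_continuousMap_apply]; rfl
  have hea' : ∀ ω t x, e' (ω, t) x = Complex.exp (-(Complex.I * ω) * (x : ℝ)) := fun ω t x => by
    simp only [e', exp_continuousMap_apply, ← neg_mul]; rfl
  let S : ℂ × ℂ → (C(Icc 0 L, ℂ) →L[ℂ] C(Icc 0 L, ℂ)) := fun p => S₀ + p.2 • S₁
  have hS : ContDiff ℂ 1 S := contDiff_const.add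
    (contDiff_smul_of (E := C(Icc 0 L, ℂ) →L[ℂ] C(Icc 0 L, ℂ)) contDiff_snd contDiff_const)
  have hSa : ∀ ω t v x, S (ω, t) v x =
      ∫ y in (0 : ℝ)..x, (V y + t * δ y) * IccExtend hL v y := fun ω t v x => by
    have hi := fun W (h : Measurable W) (hW : ∀ x, ‖W x‖ ≤ M) =>
      intervalIntegrable_of_bounded h hW (continuous_IccExtend hL v) 0 x
    calc S (ω, t) v x = S₀ v x + t * S₁ v x := rfl
      _ = _ := by
        rw [hS₀, hS₁, ← intervalIntegral.integral_const_mul,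
          ← intervalIntegral.integral_add (hi V hV hVM) ((hi δ hδ hδM).const_mul t)]
        exact intervalIntegral.integral_congr fun y _ => by ring
  let m := ContinuousLinearMap.mul ℂ C(Icc 0 L, ℂ)
  let T : ℂ × ℂ → (C(Icc 0 L, ℂ) →L[ℂ] C(Icc 0 L, ℂ)) := fun p => (Complex.I * p.1 / 2) •
    ((m (e p)).comp ((S p).comp (m (e' p))) - (m (e' p)).comp ((S p).comp (m (e p))))
  have hT : ContDiff ℂ 1 T := by
    have h1 : ContDiff ℂ 1 (fun p => m (e p)) := contDiff_mulLeft (A := C(Icc 0 L, ℂ)) he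
    have h2 : ContDiff ℂ 1 (fun p => m (e' p)) := contDiff_mulLeft (A := C(Icc 0 L, ℂ)) he'
    exact contDiff_smul_of (E := C(Icc 0 L, ℂ) →L[ℂ] C(Icc 0 L, ℂ))
      (a := fun p => Complex.I * p.1 / 2) (by fun_prop)
      ((h1.clm_comp (hS.clm_comp h2)).sub (h2.clm_comp (hS.clm_comp h1)))
  have hSe : ∀ ω t v x, S (ω, t) (e (ω, t) * v) x = ∫ y in (0 : ℝ)..x,
      (V y + t * δ y) * (Complex.exp (Complex.I * ω * y) * IccExtend hL v y) := fun ω t v x => by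
    rw [hSa]
    refine intervalIntegral.integral_congr fun y hy => ?_
    rw [uIcc_of_le x.2.1] at hy
    have hyL : y ∈ Icc 0 L := ⟨hy.1, hy.2.trans x.2.2⟩
    simp only [IccExtend_of_mem hL _ hyL, ContinuousMap.mul_apply, hea]
  have hSe' : ∀ ω t v x, S (ω, t) (e' (ω, t) * v) x = ∫ y in (0 : ℝ)..x,
      (V y + t * δ y) * (Complex.exp (-(Complex.I * ω) * y) * IccExtend hL v y) := fun ω t v x => by
    rw [hSa]
    refine intervalIntegral.integral_congr fun y hy => ?_
    rw [uIcc_of_le x.2.1] at hy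
    have hyL : y ∈ Icc 0 L := ⟨hy.1, hy.2.trans x.2.2⟩
    simp only [IccExtend_of_mem hL _ hyL, ContinuousMap.mul_apply, hea']
  have hTa : ∀ ω t v x, T (ω, t) v x =
      volterra ω (fun y => V y + t * δ y) (IccExtend hL v) x := fun ω t v x => by
    calc T (ω, t) v x = Complex.I * ω / 2 * (e (ω, t) x * S (ω, t) (e' (ω, t) * v) x -
          e' (ω, t) x * S (ω, t) (e (ω, t) * v) x) := rfl
      _ = _ := by rw [hSe, hSe', hea, hea', volterra]
  -- Quasi-nilpotency holds for every `(ω, t)`, so the solution and `F` are defined and smooth on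
  -- all of `ℂ × ℂ`.
  have hunit : ∀ p, IsUnit (1 - T p) := by
    rintro ⟨ω, t⟩
    have hSb : ∀ (a b v : C(Icc 0 L, ℂ)) (x : Icc 0 L), ‖a x * S (ω, t) (b * v) x‖ ≤
        ‖a‖ * ((M + ‖t‖ * M) * ‖b‖) * ∫ y in (0 : ℝ)..x, ‖IccExtend hL v y‖ :=
      fun a b v x => by
        rw [norm_mul, mul_assoc]
        refine mul_le_mul (a.norm_coe_le_norm x) ?_ (norm_nonneg _) (norm_nonneg _)
        rw [hSa, ← intervalIntegral.integral_const_mul]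
        refine intervalIntegral.norm_integral_le_of_norm_le x.2.1 (Eventually.of_forall
          fun y hy => ?_) ((continuous_IccExtend hL v).norm.const_mul _ |>.intervalIntegrable _ _)
        have h1 : ‖V y + t * δ y‖ ≤ M + ‖t‖ * M := (norm_add_le _ _).trans (by
          rw [norm_mul]
          exact add_le_add (hVM y) (mul_le_mul_of_nonneg_left (hδM y) (norm_nonneg _)))
        have h2 : ‖IccExtend hL (b * v) y‖ ≤ ‖b‖ * ‖IccExtend hL v y‖ := by
          simp only [IccExtend, Function.comp, ContinuousMap.mul_apply, norm_mul]
          exact mul_le_mul_of_nonneg_right (b.norm_coe_le_norm _) (norm_nonneg _)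
        rw [norm_mul, mul_assoc]
        exact mul_le_mul h1 h2 (norm_nonneg _) (by positivity)
    refine isUnit_one_sub_of_volterra hL (T (ω, t)) (c := ‖Complex.I * ω / 2‖ *
      (‖e (ω, t)‖ * ((M + ‖t‖ * M) * ‖e' (ω, t)‖) + ‖e' (ω, t)‖ * ((M + ‖t‖ * M) * ‖e (ω, t)‖)))
      (by positivity) fun v x => ?_
    calc ‖T (ω, t) v x‖ = ‖Complex.I * ω / 2 * (e (ω, t) x * S (ω, t) (e' (ω, t) * v) x -
          e' (ω, t) x * S (ω, t) (e (ω, t) * v) x)‖ := rfl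
      _ ≤ _ := by
        rw [norm_mul, mul_assoc, add_mul]
        exact mul_le_mul_of_nonneg_left ((norm_sub_le _ _).trans
          (add_le_add (hSb _ _ _ _) (hSb _ _ _ _))) (norm_nonneg _)
  have hinv : ContDiff ℂ 1 (fun p => Ring.inverse (1 - T p)) :=
    contDiff_inverse_one_sub (R := C(Icc 0 L, ℂ) →L[ℂ] C(Icc 0 L, ℂ)) hT hunit
  have hφ : ContDiff ℂ 1 (fun p => Ring.inverse (1 - T p) (e' p)) := hinv.clm_apply he'
  have hsol : ∀ p, Ring.inverse (1 - T p) (e' p) - T p (Ring.inverse (1 - T p) (e' p)) = e' p :=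
    fun p => DFunLike.congr_fun (Ring.mul_inverse_cancel _ (hunit p)) (e' p)
  -- A resonance function satisfies `u = A e^{-iωx} + T u` with `A` its own amplitude, so `u = A φ`
  -- for `φ = (1 - T)⁻¹ e^{-iωx}`, and consistency demands that `φ` have amplitude `1`. `F` measures
  -- the defect.
  refine ⟨fun p => Ring.inverse (1 - T p) (e' p), fun p => 1 - (Complex.I * p.1 / 2) *
    S p (e p * Ring.inverse (1 - T p) (e' p)) ⟨L, hL, le_rfl⟩, ?_, hφ.continuous, ?_, ?_, ?_⟩
  · have h1 : ContDiff ℂ 1 (fun p => S p (e p * Ring.inverse (1 - T p) (e' p))) :=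
      hS.clm_apply (he.mul hφ)
    have h2 := (ContinuousMap.evalCLM ℂ (⟨L, hL, le_rfl⟩ : Icc 0 L) :
      C(Icc 0 L, ℂ) →L[ℂ] ℂ).contDiff.comp h1
    exact contDiff_const.sub (ContDiff.mul (by fun_prop) h2)
  · intro ω t
    simp only [amplitude]
    rw [hSe]
  · intro ω t x hx
    have h := DFunLike.congr_fun (hsol (ω, t)) ⟨x, hx⟩
    rw [ContinuousMap.sub_apply, hTa, hea'] at h
    rw [← h, IccExtend_of_mem hL _ hx]
    ring
  · intro ω t c ψ hψ hψe x hx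
    let v : C(Icc 0 L, ℂ) := ⟨fun x => ψ x, by fun_prop⟩
    have hv : v - T (ω, t) v = c • e' (ω, t) := by
      ext y
      rw [ContinuousMap.sub_apply, hTa, ContinuousMap.smul_apply, hea', smul_eq_mul]
      have : volterra ω (fun y => V y + t * δ y) (IccExtend hL v) y =
          volterra ω (fun y => V y + t * δ y) ψ y := by
        have hc : ∀ z ∈ uIcc (0 : ℝ) y, IccExtend hL v z = ψ z := fun z hz => by
          rw [uIcc_of_le y.2.1] at hz
          rw [IccExtend_of_mem hL _ ⟨hz.1, hz.2.trans y.2.2⟩]; rfl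
        exact volterra_congr _ _ hc
      rw [this]
      change ψ y - _ = _
      rw [hψe y y.2]; ring
    have h2 : v = c • Ring.inverse (1 - T (ω, t)) (e' (ω, t)) := by
      have h3 : Ring.inverse (1 - T (ω, t)) (v - T (ω, t) v) = v :=
        DFunLike.congr_fun (Ring.inverse_mul_cancel _ (hunit (ω, t))) v
      rw [← h3, hv, map_smul]
    rw [IccExtend_of_mem hL _ hx]
    exact DFunLike.congr_fun h2 ⟨x, hx⟩

/-- On `[0, L]` the outgoing Green's operator is the sum of a wave moving to the left and of the
Volterra part. -/
theorem green_integral_eq {L : ℝ} {ω : ℂ} (hω : ω ≠ 0) {W ψ : ℝ → ℂ}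
    (h : LocallyIntegrable (fun y => W y * ψ y) volume) {x : ℝ} (hx : x ∈ Icc 0 L) :
    ω ^ 2 * ∫ y in Icc 0 L, green ω |x - y| * W y * ψ y =
      amplitude L ω W ψ * Complex.exp (-(Complex.I * ω) * x) + volterra ω W ψ x := by
  have hi : ∀ {g : ℝ → ℂ}, Continuous g → ∀ a b,
      IntervalIntegrable (fun y => W y * (g y * ψ y)) volume a b := fun {g} hg a b =>
    locallyIntegrable_intervalIntegrable ((locallyIntegrable_mul_continuous h hg).congr
      (Eventually.of_forall fun y => by ring)) a b
  have hp := hi (g := fun y : ℝ => Complex.exp (Complex.I * ω * y)) (by fun_prop)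
  have hm := hi (g := fun y : ℝ => Complex.exp (-(Complex.I * ω) * y)) (by fun_prop)
  have hg : ∀ a b, IntervalIntegrable (fun y => green ω |x - y| * W y * ψ y) volume a b :=
    fun a b => (hi (g := fun y => green ω |x - y|) (by unfold green; fun_prop) a b).congr
      (fun y _ => by ring)
  rw [integral_Icc_eq_integral_Ioc, ← intervalIntegral.integral_of_le (hx.1.trans hx.2),
    ← intervalIntegral.integral_add_adjacent_intervals (hg 0 x) (hg x L)]
  have h2 : ∫ y in (0 : ℝ)..x, green ω |x - y| * W y * ψ y =
      -(2 * Complex.I * ω)⁻¹ * Complex.exp (Complex.I * ω * x) *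
        ∫ y in (0 : ℝ)..x, W y * (Complex.exp (-(Complex.I * ω) * y) * ψ y) := by
    rw [← intervalIntegral.integral_const_mul]
    refine intervalIntegral.integral_congr fun y hy => ?_
    rw [uIcc_of_le hx.1] at hy
    have : |x - y| = x - y := abs_of_nonneg (sub_nonneg.2 hy.2)
    simp only [green, this]
    have he : Complex.exp (Complex.I * ω * ((x - y : ℝ) : ℂ)) =
        Complex.exp (Complex.I * ω * x) * Complex.exp (-(Complex.I * ω) * y) := by
      rw [← Complex.exp_add]; congr 1; push_cast; ring
    rw [he]; ring
  have h3 : ∫ y in x..L, green ω |x - y| * W y * ψ y =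
      -(2 * Complex.I * ω)⁻¹ * Complex.exp (-(Complex.I * ω) * x) *
        ∫ y in x..L, W y * (Complex.exp (Complex.I * ω * y) * ψ y) := by
    rw [← intervalIntegral.integral_const_mul]
    refine intervalIntegral.integral_congr fun y hy => ?_
    rw [uIcc_of_le hx.2] at hy
    have : |x - y| = y - x := by
      rw [abs_sub_comm]; exact abs_of_nonneg (sub_nonneg.2 hy.1)
    simp only [green, this]
    have he : Complex.exp (Complex.I * ω * ((y - x : ℝ) : ℂ)) =
        Complex.exp (-(Complex.I * ω) * x) * Complex.exp (Complex.I * ω * y) := by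
      rw [← Complex.exp_add]; congr 1; push_cast; ring
    rw [he]; ring
  -- Replacing `∫_x^L` by `∫_0^L - ∫_0^x` produces the amplitude and the second half of the Volterra
  -- term.
  rw [h2, h3, amplitude, volterra,
    ← intervalIntegral.integral_add_adjacent_intervals (hp 0 x) (hp x L)]
  have hI : (2 * Complex.I * ω)⁻¹ = -Complex.I / (2 * ω) := by
    rw [mul_inv, mul_inv, Complex.inv_I]; field_simp
  rw [hI]
  field_simp
  ring

/-! ### Motion of a multiple zero under perturbation -/

/-- Perturbation of a zero of arbitrary order `m`: if `F(z, 0) = (z - ω)^m g(z)`, `g(ω) ≠ 0`, and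
`-∂ₜF(ω, 0) / g(ω)` lies in the upper half plane, then for small `t > 0` the function `F(·, t)`
has a zero near `ω` that lies strictly above `ω`. -/
theorem exists_zero_of_perturbation {F : ℂ × ℂ → ℂ} {F' : ℂ × ℂ →L[ℂ] ℂ} {g : ℂ → ℂ} {ω : ℂ}
    {m : ℕ} (hF : Differentiable ℂ F) (hF' : HasStrictFDerivAt F F' (ω, 0))
    (hg : ContinuousAt g ω) (hgω : g ω ≠ 0) (hm : m ≠ 0)
    (hfac : ∀ᶠ z in 𝓝 ω, F (z, 0) = (z - ω) ^ m * g z)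
    (him : 0 < (-F' (0, 1) / g ω).im) {ε : ℝ} (hε : 0 < ε) :
    ∃ t : ℝ, 0 < t ∧ t < ε ∧ ∃ z : ℂ, ‖z - ω‖ < ε ∧ ω.im < z.im ∧ F (z, (t : ℂ)) = 0 := by
  set B := F' (0, 1) with hB
  set D := -B / g ω with hD
  have hD0 : D ≠ 0 := by rintro h; rw [h] at him; simp at him
  -- The principal root has argument `arg D / m`, which stays in `(0, π)`.
  obtain ⟨ζ₀, hζ₀, hζ₀im⟩ : ∃ ζ : ℂ, ζ ^ m = D ∧ 0 < ζ.im := by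
    refine ⟨D ^ ((m : ℂ)⁻¹), Complex.cpow_nat_inv_pow D hm, ?_⟩
    have hpos : 0 < D.arg ∧ D.arg < Real.pi :=
      ⟨lt_of_le_of_ne (Complex.arg_nonneg_iff.2 him.le) fun h => by
          have := Complex.arg_eq_zero_iff.1 h.symm; rw [this.2] at him; exact lt_irrefl _ him,
        lt_of_le_of_ne (Complex.arg_le_pi D) fun h => by
          have := Complex.arg_eq_pi_iff.1 h; rw [this.2] at him; exact lt_irrefl _ him⟩
    have hm1 : (1 : ℝ) ≤ m := by exact_mod_cast Nat.one_le_iff_ne_zero.2 hm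
    rw [Complex.cpow_def_of_ne_zero hD0, Complex.exp_im]
    have him2 : (Complex.log D * (m : ℂ)⁻¹).im = D.arg / m := by
      rw [← Complex.ofReal_natCast, ← Complex.ofReal_inv, Complex.im_mul_ofReal, Complex.log_im]
      rfl
    rw [him2]
    refine mul_pos (Real.exp_pos _) (Real.sin_pos_of_pos_of_lt_pi
      (div_pos hpos.1 (by linarith)) ?_)
    exact lt_of_le_of_lt (div_le_self hpos.1.le hm1) hpos.2
  have hζ₀0 : ζ₀ ≠ 0 := by rintro rfl; simp at hζ₀im
  -- Newton–Puiseux scaling: with `t = s ^ m` and `z = ω + s ζ`, the quotient `F (z, t) / s ^ m`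
  -- tends to this polynomial, of which `ζ₀` is a simple root.
  let h : ℂ → ℂ := fun ζ => g ω * ζ ^ m + B
  have hhζ₀ : h ζ₀ = 0 := by
    simp only [h, hζ₀, hD]; field_simp; ring
  have hhne : ∀ᶠ ζ in 𝓝[≠] ζ₀, h ζ ≠ 0 := by
    have hder : HasDerivAt h (g ω * (m * ζ₀ ^ (m - 1))) ζ₀ :=
      ((hasDerivAt_pow m ζ₀).const_mul _).add_const _
    have := hder.eventually_ne (c := 0) (mul_ne_zero hgω (mul_ne_zero (Nat.cast_ne_zero.2 hm)
      (pow_ne_zero _ hζ₀0)))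
    exact this
  obtain ⟨r₀, hr₀, hr₀ne⟩ := Metric.mem_nhdsWithin_iff.1 hhne
  -- The closed ball of radius `r` about `ζ₀` contains no other root of `h` and stays in the upper
  -- half plane.
  set r := min (r₀ / 2) (ζ₀.im / 2) with hr
  have hrpos : 0 < r := lt_min (by linarith) (by linarith)
  have hrr₀ : r < r₀ := lt_of_le_of_lt (min_le_left _ _) (by linarith)
  have hrim : r < ζ₀.im := lt_of_le_of_lt (min_le_right _ _) (by linarith)
  have hhc : Continuous h := by fun_prop
  obtain ⟨ζ₁, hζ₁, hmin⟩ := (isCompact_sphere ζ₀ r).exists_isMinOn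
    (NormedSpace.sphere_nonempty.2 hrpos.le) hhc.norm.continuousOn
  set η := ‖h ζ₁‖ with hη
  have hηpos : 0 < η := by
    refine norm_pos_iff.2 (hr₀ne ⟨?_, ?_⟩)
    · rw [Metric.mem_ball, Metric.mem_sphere.1 hζ₁]; exact hrr₀
    · rintro rfl
      rw [Metric.mem_sphere, dist_self] at hζ₁
      exact hrpos.ne hζ₁
  set R := ‖ζ₀‖ + r with hR
  have hRpos : 0 < R := by positivity
  -- Two errors, at most `κ` and `R ^ m * κ`, are to add up to `η / 8`.
  set κ := η / (8 * (R ^ m + 1)) with hκ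
  have hκpos : 0 < κ := by positivity
  obtain ⟨ρ₁, hρ₁, H₁⟩ := Metric.eventually_nhds_iff.1
    (hfac.and (Metric.continuousAt_iff'.1 hg κ hκpos))
  -- The increment in `t` is taken at the moving point `ω + s ζ`, hence the need for a strict
  -- derivative.
  obtain ⟨ρ₂, hρ₂, H₂⟩ := Metric.eventually_nhds_iff.1
    (hF'.isLittleO.def hκpos)
  obtain ⟨s, hspos, hs⟩ : ∃ s : ℝ, 0 < s ∧ s < min (min 1 ε) (min ρ₁ ρ₂) / (R + 1) := by
    have : 0 < min (min 1 ε) (min ρ₁ ρ₂) / (R + 1) := by positivity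
    exact ⟨_, half_pos this, half_lt_self this⟩
  rw [lt_div_iff₀ (by positivity)] at hs
  have hsR : s * R < min (min 1 ε) (min ρ₁ ρ₂) := by nlinarith
  have hs1 : s < min (min 1 ε) (min ρ₁ ρ₂) := by nlinarith [mul_pos hspos hRpos]
  simp only [lt_min_iff] at hsR hs1
  have hsm : s ^ m ≤ s := pow_le_of_le_one hspos.le hs1.1.1.le hm
  have hsm0 : 0 < s ^ m := by positivity
  have hsc : ((s : ℂ)) ≠ 0 := by exact_mod_cast hspos.ne'
  let f : ℂ → ℂ := fun ζ => F (ω + s * ζ, (s : ℂ) ^ m) / (s : ℂ) ^ m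
  have hnormζ : ∀ ζ ∈ Metric.closedBall ζ₀ r, ‖ζ‖ ≤ R := fun ζ hζ => by
    have h1 : ‖ζ - ζ₀‖ ≤ r := by rwa [← dist_eq_norm]
    calc ‖ζ‖ = ‖ζ₀ + (ζ - ζ₀)‖ := by congr 1; ring
      _ ≤ R := (norm_add_le _ _).trans (by linarith)
  have hnorms : ∀ ζ ∈ Metric.closedBall ζ₀ r, ‖(s : ℂ) * ζ‖ ≤ s * R := fun ζ hζ => by
    rw [norm_mul, Complex.norm_of_nonneg hspos.le]
    exact mul_le_mul_of_nonneg_left (hnormζ ζ hζ) hspos.le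
  have happrox : ∀ ζ ∈ Metric.closedBall ζ₀ r, ‖f ζ - h ζ‖ ≤ η / 8 := fun ζ hζ => by
    have hsz := hnorms ζ hζ
    have hd : dist (ω + s * ζ) ω < ρ₁ := by
      rw [dist_eq_norm, add_sub_cancel_left]; linarith
    obtain ⟨h1, h2⟩ := H₁ hd
    have h3 := H₂ (y := ((ω + s * ζ, (s : ℂ) ^ m), (ω + s * ζ, 0))) (by
      have e1 : ‖(s : ℂ) ^ m‖ = s ^ m := by rw [norm_pow, Complex.norm_of_nonneg hspos.le]
      simp only [Prod.dist_eq, max_lt_iff]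
      simp only [dist_eq_norm, add_sub_cancel_left, sub_zero, norm_zero, e1]
      refine ⟨⟨?_, ?_⟩, ?_, ?_⟩ <;> linarith)
    have hdiff : ((ω + s * ζ, (s : ℂ) ^ m) : ℂ × ℂ) - (ω + s * ζ, 0) =
        (s : ℂ) ^ m • ((0, 1) : ℂ × ℂ) := by
      simp
    simp only [hdiff, map_smul, smul_eq_mul, ← hB] at h3
    rw [norm_smul, Prod.norm_mk, norm_zero, norm_one, max_eq_right zero_le_one, mul_one] at h3
    have hsmc : (s : ℂ) ^ m ≠ 0 := pow_ne_zero _ hsc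
    have hE : f ζ - h ζ = (F (ω + s * ζ, (s : ℂ) ^ m) - F (ω + s * ζ, 0) - (s : ℂ) ^ m * B) /
        (s : ℂ) ^ m + ζ ^ m * (g (ω + s * ζ) - g ω) := by
      rw [h1]; simp only [f, h]; field_simp; ring
    rw [hE]
    refine (norm_add_le _ _).trans ?_
    have t1 : ‖(F (ω + s * ζ, (s : ℂ) ^ m) - F (ω + s * ζ, 0) - (s : ℂ) ^ m * B) /
        (s : ℂ) ^ m‖ ≤ κ := by
      rw [norm_div, div_le_iff₀ (norm_pos_iff.2 hsmc)]; exact h3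
    have t2 : ‖ζ ^ m * (g (ω + s * ζ) - g ω)‖ ≤ R ^ m * κ := by
      rw [norm_mul, norm_pow, ← dist_eq_norm]
      exact mul_le_mul (pow_le_pow_left₀ (norm_nonneg _) (hnormζ ζ hζ) _) h2.le dist_nonneg
        (by positivity)
    calc _ ≤ κ + R ^ m * κ := add_le_add t1 t2
      _ = η / 8 := by rw [hκ]; field_simp; ring
  have hfd : Differentiable ℂ f := by
    refine (hF.comp (f := fun ζ : ℂ => (ω + s * ζ, (s : ℂ) ^ m)) ?_).div_const _
    fun_prop
  have hf0 : ‖f ζ₀‖ ≤ η / 8 := by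
    simpa [hhζ₀] using happrox ζ₀ (Metric.mem_closedBall_self hrpos.le)
  have hsph : ∀ z ∈ Metric.sphere ζ₀ r, η / 2 ≤ ‖f z - f ζ₀‖ := fun z hz => by
    have h1 := happrox z (Metric.sphere_subset_closedBall hz)
    have h2 : η ≤ ‖h z‖ := hmin hz
    have h3 : ‖h z‖ ≤ ‖f z - f ζ₀‖ + ‖f z - h z‖ + ‖f ζ₀‖ := by
      calc ‖h z‖ = ‖(f z - f ζ₀) - (f z - h z) + f ζ₀‖ := by congr 1; ring
        _ ≤ _ := (norm_add_le _ _).trans (add_le_add_left (norm_sub_le _ _) _)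
    linarith
  have hnc : ∃ᶠ z in 𝓝 ζ₀, f z ≠ f ζ₀ := by
    intro hev
    simp only [ne_eq, not_not] at hev
    have ha : AnalyticOnNhd ℂ f univ := fun z _ => hfd.analyticAt z
    have := ha.eqOn_of_preconnected_of_eventuallyEq (g := fun _ => f ζ₀) analyticOnNhd_const
      isPreconnected_univ (mem_univ ζ₀) hev (mem_univ ζ₁)
    have h1 := hsph ζ₁ hζ₁
    rw [this] at h1
    simp at h1
    linarith
  -- Quantitative open mapping: the image of the ball contains the ball of radius `η / 4` about `f
  -- ζ₀`, and `‖f ζ₀‖ ≤ η / 8`, so `0` is attained.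
  have hsub := (hfd.diffContOnCl (s := Metric.ball ζ₀ r)).ball_subset_image_closedBall hrpos
    hsph hnc
  obtain ⟨ζ, hζ, hζ0⟩ := hsub (show (0 : ℂ) ∈ Metric.ball (f ζ₀) (η / 2 / 2) by
    rw [Metric.mem_ball, dist_eq_norm, zero_sub, norm_neg]; linarith)
  have hζim : 0 < ζ.im := by
    have h1 : |(ζ - ζ₀).im| ≤ r := (Complex.abs_im_le_norm _).trans (by
      rw [← dist_eq_norm]; exact hζ)
    rw [Complex.sub_im] at h1
    linarith [(abs_le.1 h1).1]
  refine ⟨s ^ m, hsm0, by linarith, ω + s * ζ, ?_, ?_, ?_⟩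
  · rw [add_sub_cancel_left]
    linarith [hnorms ζ hζ]
  · simp only [Complex.add_im, Complex.im_ofReal_mul]
    nlinarith [mul_pos hspos hζim]
  · have := (div_eq_zero_iff.1 hζ0).resolve_right (pow_ne_zero _ hsc)
    push_cast
    exact this

/-! ### Resonance pairs and zeros of the characteristic function -/

section Contrast

variable {L np : ℝ} {n : ℝ → ℝ}

theorem AdmissibleSym.bounds (hnp : 1 < np) (hn : n ∈ AdmissibleSym L 1 np) (x : ℝ) :
    1 ≤ n x ∧ n x ≤ np := by
  by_cases hx : x ∈ Icc 0 L
  · exact hn.2.1 x hx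
  · rw [hn.2.2.1 x hx]; exact ⟨le_rfl, hnp.le⟩

theorem AdmissibleSym.measurable_contrast (hn : n ∈ AdmissibleSym L 1 np) :
    Measurable (fun y => (n y : ℂ) ^ 2 - 1) :=
  ((Complex.measurable_ofReal.comp hn.1).pow_const 2).sub_const 1

theorem AdmissibleSym.norm_contrast_le (hnp : 1 < np) (hn : n ∈ AdmissibleSym L 1 np) (x : ℝ) :
    ‖(n x : ℂ) ^ 2 - 1‖ ≤ np ^ 2 := by
  obtain ⟨h1, h2⟩ := AdmissibleSym.bounds hnp hn x
  have : (n x : ℂ) ^ 2 - 1 = ((n x ^ 2 - 1 : ℝ) : ℂ) := by push_cast; ring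
  rw [this, Complex.norm_real, Real.norm_eq_abs, abs_of_nonneg (by nlinarith)]
  nlinarith

theorem AdmissibleSym.contrast_eq_zero (hn : n ∈ AdmissibleSym L 1 np) {x : ℝ}
    (hx : x ∉ Icc 0 L) : (n x : ℂ) ^ 2 - 1 = 0 := by
  rw [hn.2.2.1 x hx]; simp

end Contrast

theorem locallyIntegrable_bounded_mul {V u : ℝ → ℂ} {M : ℝ} (hV : Measurable V)
    (hM : ∀ x, ‖V x‖ ≤ M) (hu : LocallyIntegrable u volume) :
    LocallyIntegrable (fun y => V y * u y) volume := by
  have h : LocallyIntegrable (fun y => (M : ℂ) * u y) volume := hu.smul (M : ℂ)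
  refine h.mono (hV.aestronglyMeasurable.mul hu.aestronglyMeasurable)
    (Eventually.of_forall fun y => ?_)
  rw [norm_mul, norm_mul, Complex.norm_real, Real.norm_eq_abs]
  exact mul_le_mul_of_nonneg_right ((hM y).trans (le_abs_self _)) (norm_nonneg _)

theorem amplitude_congr {L : ℝ} (hL : 0 ≤ L) (ω : ℂ) (W : ℝ → ℂ) {ψ ψ' : ℝ → ℂ}
    (h : ∀ z ∈ Icc 0 L, ψ z = ψ' z) : amplitude L ω W ψ = amplitude L ω W ψ' := by
  simp only [amplitude]
  congr 1
  refine intervalIntegral.integral_congr fun z hz => ?_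
  rw [uIcc_of_le hL] at hz
  simp only [h z hz]

theorem amplitude_const_mul (L : ℝ) (ω : ℂ) (W : ℝ → ℂ) (c : ℂ) (ψ : ℝ → ℂ) :
    amplitude L ω W (fun y => c * ψ y) = c * amplitude L ω W ψ := by
  simp only [amplitude]
  rw [mul_left_comm, ← intervalIntegral.integral_const_mul c]
  congr 1
  exact intervalIntegral.integral_congr fun z _ => by ring

namespace IsResonancePair

variable {L np : ℝ} {n : ℝ → ℝ} {ω : ℂ} {u : ℝ → ℂ}

theorem ne_zero (h : IsResonancePair L n ω u) : ω ≠ 0 := by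
  rintro rfl
  exact h.nontrivial (funext fun x => by rw [h.eq x]; simp)

theorem locallyIntegrable_contrast_mul (hnp : 1 < np) (hn : n ∈ AdmissibleSym L 1 np)
    (h : IsResonancePair L n ω u) :
    LocallyIntegrable (fun y => ((n y : ℂ) ^ 2 - 1) * u y) volume :=
  locallyIntegrable_bounded_mul (AdmissibleSym.measurable_contrast hn)
    (AdmissibleSym.norm_contrast_le hnp hn) h.locallyIntegrable

/-- A resonance function solves `u'' = -ω² n² u` with outgoing boundary conditions. -/
theorem exists_deriv (hnp : 1 < np) (hn : n ∈ AdmissibleSym L 1 np)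
    (h : IsResonancePair L n ω u) :
    ∃ w, IsPrimitive u w ∧ IsPrimitive w (fun x => -ω ^ 2 * ((n x : ℂ) ^ 2 * u x)) ∧
      w 0 = -(Complex.I * ω) * u 0 ∧ w L = Complex.I * ω * u L := by
  obtain ⟨w, h1, h2, h3, h4⟩ := exists_deriv_of_green (u := u) h.ne_zero
    (h.locallyIntegrable_contrast_mul hnp hn)
    (fun x hx => by rw [AdmissibleSym.contrast_eq_zero hn hx, zero_mul])
    (fun x => by rw [h.eq x]; simp only [mul_assoc])
  exact ⟨w, h1, h2.congr (fun _ => rfl) fun x => by ring, h3, h4⟩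

theorem continuous (hnp : 1 < np) (hn : n ∈ AdmissibleSym L 1 np)
    (h : IsResonancePair L n ω u) : Continuous u := by
  obtain ⟨w, h1, -⟩ := h.exists_deriv hnp hn
  exact h1.continuous

theorem eq_volterra (hnp : 1 < np) (hn : n ∈ AdmissibleSym L 1 np)
    (h : IsResonancePair L n ω u) {x : ℝ} (hx : x ∈ Icc 0 L) :
    u x = amplitude L ω (fun y => (n y : ℂ) ^ 2 - 1) u * Complex.exp (-(Complex.I * ω) * x) +
      volterra ω (fun y => (n y : ℂ) ^ 2 - 1) u x := by
  rw [← green_integral_eq h.ne_zero (h.locallyIntegrable_contrast_mul hnp hn) hx, ← h.eq x]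

/-- The integral equation recovers `u` on the whole line from its values on `[0, L]`. -/
theorem not_eqOn_zero (h : IsResonancePair L n ω u) : ¬ ∀ x ∈ Icc 0 L, u x = 0 := fun h0 =>
  h.nontrivial (funext fun x => by
    rw [h.eq x, setIntegral_congr_fun (g := fun _ => 0) measurableSet_Icc
      fun y hy => by simp [h0 y hy]]
    simp)

/-- The reflection of a resonance function of a symmetric structure is a resonance function. -/
theorem reflect (hnp : 1 < np) (hn : n ∈ AdmissibleSym L 1 np)
    (h : IsResonancePair L n ω u) : IsResonancePair L n ω (fun x => u (L - x)) := by
  have hinv : ∀ f : ℝ → ℂ, ∫ y in Icc 0 L, f (L - y) = ∫ y in Icc 0 L, f y := fun f => by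
    rw [← integral_indicator measurableSet_Icc, ← integral_indicator measurableSet_Icc,
      ← integral_sub_left_eq_self _ volume L]
    refine integral_congr_ae (Eventually.of_forall fun y => ?_)
    have : L - y ∈ Icc 0 L ↔ y ∈ Icc 0 L := by
      simp only [mem_Icc]; constructor <;> rintro ⟨h1, h2⟩ <;> constructor <;> linarith
    simp only
    by_cases hy : y ∈ Icc 0 L
    · rw [indicator_of_mem hy, indicator_of_mem (this.2 hy), sub_sub_cancel]
    · rw [indicator_of_notMem hy, indicator_of_notMem (fun h => hy (this.1 h))]
  refine ⟨?_, fun h0 => h.nontrivial (funext fun x => ?_), fun x => ?_⟩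
  · have hc := h.continuous hnp hn
    exact (by fun_prop : Continuous fun x => u (L - x)).locallyIntegrable
  · have := congrFun h0 (L - x)
    simpa using this
  · rw [h.eq (L - x), ← hinv]
    congr 1
    refine setIntegral_congr_fun measurableSet_Icc fun y _ => ?_
    rw [hn.2.2.2 y, show L - x - (L - y) = y - x by ring, abs_sub_comm]

end IsResonancePair

/-- A solution of the Volterra equation with unit amplitude extends to a resonance function. -/
theorem exists_isResonancePair {L : ℝ} (hL : 0 ≤ L) {n : ℝ → ℝ} {np : ℝ} (hnp : 1 < np)
    (hn : n ∈ AdmissibleSym L 1 np) {ω : ℂ} (hω : ω ≠ 0) {ψ : ℝ → ℂ} (hψ : Continuous ψ)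
    (heq : ∀ x ∈ Icc 0 L, ψ x = Complex.exp (-(Complex.I * ω) * x) +
      volterra ω (fun y => (n y : ℂ) ^ 2 - 1) ψ x)
    (hamp : amplitude L ω (fun y => (n y : ℂ) ^ 2 - 1) ψ = 1) :
    ∃ u, IsResonancePair L n ω u := by
  have hloc : LocallyIntegrable (fun y => ((n y : ℂ) ^ 2 - 1) * ψ y) volume :=
    locallyIntegrable_bounded_mul (AdmissibleSym.measurable_contrast hn)
      (AdmissibleSym.norm_contrast_le hnp hn) hψ.locallyIntegrable
  set u : ℝ → ℂ := fun x => ω ^ 2 *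
    ∫ y in Icc 0 L, green ω |x - y| * ((n y : ℂ) ^ 2 - 1) * ψ y with hu
  have huψ : ∀ x ∈ Icc 0 L, u x = ψ x := fun x hx => by
    rw [hu]
    simp only
    rw [green_integral_eq hω hloc hx, hamp, one_mul, ← heq x hx]
  obtain ⟨w, hw, -⟩ := exists_deriv_of_green (u := u) hω hloc
    (fun x hx => by rw [AdmissibleSym.contrast_eq_zero hn hx, zero_mul])
    (fun x => by simp only [hu, mul_assoc])
  refine ⟨u, hw.continuous.locallyIntegrable, fun h0 => ?_, fun x => ?_⟩
  -- The Volterra term vanishes at `0`, so `ψ 0 = 1`.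
  · have h1 := huψ 0 ⟨le_rfl, hL⟩
    rw [h0, heq 0 ⟨le_rfl, hL⟩] at h1
    simp [volterra] at h1
  · rw [setIntegral_congr_fun (g := fun y => green ω |x - y| * ((n y : ℂ) ^ 2 - 1) * ψ y)
      measurableSet_Icc fun y hy => by simp only [huψ y hy]]

/-! ### Derivative of the characteristic function in the coefficient -/

/-- The kernel depends only on `|x - y|` and is bounded on the square, so this is Fubini. -/
theorem integral_green_symm {L : ℝ} (ω : ℂ) {f g : ℝ → ℂ} (hf : IntegrableOn f (Icc 0 L))
    (hg : IntegrableOn g (Icc 0 L)) :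
    ∫ x in Icc 0 L, f x * ∫ y in Icc 0 L, green ω |x - y| * g y =
      ∫ y in Icc 0 L, (∫ x in Icc 0 L, green ω |y - x| * f x) * g y := by
  have hc : Continuous fun p : ℝ × ℝ => green ω |p.1 - p.2| := by unfold green; fun_prop
  obtain ⟨C, hC⟩ := (isCompact_Icc.prod isCompact_Icc :
    IsCompact (Icc 0 L ×ˢ Icc 0 L)).exists_bound_of_continuousOn hc.continuousOn
  have hint : Integrable (fun p : ℝ × ℝ => green ω |p.1 - p.2| * (f p.1 * g p.2))
      ((volume.restrict (Icc 0 L)).prod (volume.restrict (Icc 0 L))) := by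
    refine (Integrable.mul_prod hf hg).bdd_mul hc.aestronglyMeasurable (c := C) ?_
    rw [Measure.prod_restrict]
    filter_upwards [ae_restrict_mem (measurableSet_Icc.prod measurableSet_Icc)] with p hp
    exact hC p hp
  have h1 : ∀ x, f x * ∫ y in Icc 0 L, green ω |x - y| * g y =
      ∫ y in Icc 0 L, green ω |x - y| * (f x * g y) := fun x => by
    rw [← integral_const_mul]
    exact integral_congr_ae (Eventually.of_forall fun y => by ring)
  have h2 : ∀ y, (∫ x in Icc 0 L, green ω |y - x| * f x) * g y =
      ∫ x in Icc 0 L, green ω |x - y| * (f x * g y) := fun y => by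
    rw [← integral_mul_const]
    exact integral_congr_ae (Eventually.of_forall fun x => by
      simp only [abs_sub_comm y x]; ring)
  simp only [h1, h2]
  exact integral_integral_swap hint

theorem integrableOn_bounded_mul {L : ℝ} {V u : ℝ → ℂ} {M : ℝ} (hV : Measurable V)
    (hM : ∀ x, ‖V x‖ ≤ M) (hu : Continuous u) :
    IntegrableOn (fun y => V y * u y) (Icc 0 L) :=
  (locallyIntegrable_bounded_mul hV hM hu.locallyIntegrable).integrableOn_isCompact isCompact_Icc

/-- Green's identity for the solutions of the Volterra equations with two coefficients. -/
theorem charFun_mul_integral {L : ℝ} {ω : ℂ} (hω : ω ≠ 0) {V V' φ ψ : ℝ → ℂ}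
    {M M' : ℝ} (hV : Measurable V) (hVM : ∀ x, ‖V x‖ ≤ M) (hV' : Measurable V')
    (hVM' : ∀ x, ‖V' x‖ ≤ M') (hφ : Continuous φ) (hψ : Continuous ψ)
    (hφe : ∀ x ∈ Icc 0 L, φ x = Complex.exp (-(Complex.I * ω) * x) + volterra ω V φ x)
    (hφa : amplitude L ω V φ = 1)
    (hψe : ∀ x ∈ Icc 0 L, ψ x = Complex.exp (-(Complex.I * ω) * x) + volterra ω V' ψ x) :
    (1 - amplitude L ω V' ψ) *
        (∫ x in Icc 0 L, V x * (Complex.exp (-(Complex.I * ω) * x) * φ x)) =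
      ∫ x in Icc 0 L, (V x - V' x) * (φ x * ψ x) := by
  have hVφ := locallyIntegrable_bounded_mul hV hVM hφ.locallyIntegrable
  have hVψ := locallyIntegrable_bounded_mul hV' hVM' hψ.locallyIntegrable
  have hφg : ∀ x ∈ Icc 0 L, φ x = ω ^ 2 * ∫ y in Icc 0 L, green ω |x - y| * (V y * φ y) :=
    fun x hx => by
      simp only [← mul_assoc]
      rw [green_integral_eq hω hVφ hx, hφa, one_mul, ← hφe x hx]
  have hψg : ∀ x ∈ Icc 0 L, ψ x = (1 - amplitude L ω V' ψ) * Complex.exp (-(Complex.I * ω) * x) +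
      ω ^ 2 * ∫ y in Icc 0 L, green ω |x - y| * (V' y * ψ y) := fun x hx => by
    simp only [← mul_assoc]
    rw [green_integral_eq hω hVψ hx]
    linear_combination hψe x hx
  have hsymm := integral_green_symm ω (hVφ.integrableOn_isCompact (isCompact_Icc (a := 0) (b := L)))
    (hVψ.integrableOn_isCompact (isCompact_Icc (a := 0) (b := L)))
  have i1 : IntegrableOn (fun x => V x * (φ x * ψ x)) (Icc 0 L) :=
    integrableOn_bounded_mul hV hVM (hφ.mul hψ)
  have i2 : IntegrableOn (fun x => V' x * (φ x * ψ x)) (Icc 0 L) :=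
    integrableOn_bounded_mul hV' hVM' (hφ.mul hψ)
  have i3 : IntegrableOn (fun x : ℝ => V x * (Complex.exp (-(Complex.I * ω) * x) * φ x))
      (Icc 0 L) := integrableOn_bounded_mul hV hVM (by fun_prop)
  -- Symmetry moves the Green's operator from `V' ψ` onto `V φ`, where `ω² G (V φ) = φ` because `φ`
  -- has amplitude one.
  have e1 : ∫ x in Icc 0 L, V' x * (φ x * ψ x) =
      ω ^ 2 * ∫ x in Icc 0 L, V x * φ x * ∫ y in Icc 0 L, green ω |x - y| * (V' y * ψ y) := by
    rw [hsymm, ← integral_const_mul]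
    refine setIntegral_congr_fun measurableSet_Icc fun x hx => ?_
    linear_combination (V' x * ψ x) * hφg x hx
  have e2 : (1 - amplitude L ω V' ψ) *
      (∫ x in Icc 0 L, V x * (Complex.exp (-(Complex.I * ω) * x) * φ x)) =
      ∫ x in Icc 0 L, (V x * (φ x * ψ x) -
        ω ^ 2 * (V x * φ x * ∫ y in Icc 0 L, green ω |x - y| * (V' y * ψ y))) := by
    rw [← integral_const_mul]
    refine setIntegral_congr_fun measurableSet_Icc fun x hx => ?_
    linear_combination -(V x * φ x) * hψg x hx
  have i4 : IntegrableOn (fun x => ω ^ 2 * (V x * φ x *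
      ∫ y in Icc 0 L, green ω |x - y| * (V' y * ψ y))) (Icc 0 L) := by
    refine (i1.sub (i3.const_mul (1 - amplitude L ω V' ψ))).congr_fun (fun x hx => ?_)
      measurableSet_Icc
    simp only [Pi.sub_apply]
    linear_combination (V x * φ x) * hψg x hx
  rw [e2, integral_sub i1 i4, integral_const_mul, ← e1, ← integral_sub i1 i2]
  exact integral_congr_ae (Eventually.of_forall fun x => by ring)

/-- The value at the right end in terms of the amplitude of the wave emitted to the right. -/
theorem eq_integral_of_amplitude_eq_one {L : ℝ} (hL : 0 ≤ L) {ω : ℂ} {V φ : ℝ → ℂ}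
    (hφe : ∀ x ∈ Icc 0 L, φ x = Complex.exp (-(Complex.I * ω) * x) + volterra ω V φ x)
    (hφa : amplitude L ω V φ = 1) :
    φ L = Complex.I * ω / 2 * (Complex.exp (Complex.I * ω * L) *
      ∫ x in Icc 0 L, V x * (Complex.exp (-(Complex.I * ω) * x) * φ x)) := by
  have h := hφe L ⟨hL, le_rfl⟩
  rw [integral_Icc_eq_integral_Ioc, ← intervalIntegral.integral_of_le hL]
  simp only [volterra] at h
  simp only [amplitude] at hφa
  linear_combination h - Complex.exp (-(Complex.I * ω) * L) * hφa

/-- The difference quotient at `0` is `K` itself, so continuity of `K` suffices. -/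
theorem hasDerivAt_mul_of_continuousAt {K : ℂ → ℂ} (hK : ContinuousAt K 0) :
    HasDerivAt (fun t => t * K t) (K 0) 0 := by
  rw [hasDerivAt_iff_tendsto_slope]
  refine (hK.tendsto.mono_left nhdsWithin_le_nhds).congr' ?_
  filter_upwards [self_mem_nhdsWithin] with t ht
  rw [slope_def_field]
  field_simp [show t ≠ 0 from ht]
  simp

/-- The derivative in `t` of the characteristic function at a resonance. -/
theorem fderiv_charFun_mul {L : ℝ} (hL : 0 ≤ L) {ω : ℂ} (hω : ω ≠ 0) {V δ : ℝ → ℂ} {M : ℝ}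
    (hV : Measurable V) (hVM : ∀ x, ‖V x‖ ≤ M) (hδ : Measurable δ) (hδM : ∀ x, ‖δ x‖ ≤ M)
    {φ : ℂ × ℂ → C(Icc 0 L, ℂ)} {F : ℂ × ℂ → ℂ} {F' : ℂ × ℂ →L[ℂ] ℂ}
    (hF' : HasFDerivAt F F' (ω, 0)) (hφ : Continuous φ)
    (hF : ∀ t, F (ω, t) = 1 - amplitude L ω (fun y => V y + t * δ y) (IccExtend hL (φ (ω, t))))
    (hφe : ∀ t, ∀ x ∈ Icc 0 L, IccExtend hL (φ (ω, t)) x = Complex.exp (-(Complex.I * ω) * x) +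
        volterra ω (fun y => V y + t * δ y) (IccExtend hL (φ (ω, t))) x)
    (hF0 : F (ω, 0) = 0) :
    F' (0, 1) * (∫ x in Icc 0 L, V x * (Complex.exp (-(Complex.I * ω) * x) *
        IccExtend hL (φ (ω, 0)) x)) =
      -∫ x in Icc 0 L, δ x * IccExtend hL (φ (ω, 0)) x ^ 2 := by
  set N := ∫ x in Icc 0 L, V x * (Complex.exp (-(Complex.I * ω) * x) *
        IccExtend hL (φ (ω, 0)) x) with hN
  have hM : 0 ≤ M := (norm_nonneg _).trans (hVM 0)
  have hc := fun t => continuous_IccExtend hL (φ (ω, t))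
  obtain ⟨S, hS⟩ := exists_primitiveOp hL (V := fun y => δ y * IccExtend hL (φ (ω, 0)) y)
    (M := M * ‖φ (ω, 0)‖) (hδ.mul (hc 0).measurable) (fun x => by
      rw [norm_mul]
      exact mul_le_mul (hδM x) ((φ (ω, 0)).norm_coe_le_norm _) (norm_nonneg _) hM)
  set K : ℂ → ℂ := fun t => S (φ (ω, t)) ⟨L, hL, le_rfl⟩ with hK
  have hKc : Continuous K := by
    have h1 : Continuous fun t : ℂ => S (φ (ω, t)) := S.continuous.comp (hφ.comp (by fun_prop))
    exact (continuous_eval_const _).comp h1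
  have hKi : ∀ t, K t = ∫ x in Icc 0 L, δ x * (IccExtend hL (φ (ω, 0)) x *
      IccExtend hL (φ (ω, t)) x) := fun t => by
    rw [hK]
    simp only [hS]
    rw [integral_Icc_eq_integral_Ioc, ← intervalIntegral.integral_of_le hL]
    exact intervalIntegral.integral_congr fun x _ => by ring
  have hV0 : (fun y => V y + 0 * δ y) = V := by funext y; ring
  have hφ0 := hφe 0
  have ha0 := hF 0
  rw [hV0] at hφ0 ha0
  rw [hF0] at ha0
  -- Green's identity is exact in `t`; differentiating it at `0` needs only the continuity of `t ↦ φ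
  -- (ω, t)`.
  have hid : ∀ t, F (ω, t) * N = -(t * K t) := fun t => by
    rw [hF t, hN, charFun_mul_integral (V' := fun y => V y + t * δ y) (M' := M + ‖t‖ * M) hω hV hVM
      (hV.add (hδ.const_mul t)) (fun x => ?_) (hc 0) (hc t) hφ0 (by linear_combination ha0)
      (hφe t), hKi, ← integral_const_mul, ← integral_neg]
    · exact integral_congr_ae (Eventually.of_forall fun x => by ring)
    · exact (norm_add_le _ _).trans (by
          rw [norm_mul]
          exact add_le_add (hVM x) (mul_le_mul_of_nonneg_left (hδM x) (norm_nonneg _)))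
  have hd1 : HasDerivAt (fun t => F (ω, t) * N) (F' (0, 1) * N) 0 := by
    have h1 : HasDerivAt (fun t : ℂ => ((ω, t) : ℂ × ℂ)) (0, 1) 0 :=
      (hasDerivAt_const _ _).prodMk (hasDerivAt_id _)
    exact (HasFDerivAt.comp_hasDerivAt (0 : ℂ) hF' h1).mul_const N
  have hd2 : HasDerivAt (fun t => F (ω, t) * N) (-K 0) 0 := by
    rw [funext hid]
    exact (hasDerivAt_mul_of_continuousAt hKc.continuousAt).neg
  rw [hd1.unique hd2, hKi]
  congr 1
  exact integral_congr_ae (Eventually.of_forall fun x => by ring)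

/-! ### First-order optimality -/

/-- The admissible structure with `n_t² = n² + t (n₁² - n²)`. -/
theorem sqrt_interp_mem {L np t : ℝ} {n n₁ : ℝ → ℝ} (hnp : 1 < np)
    (hn : n ∈ AdmissibleSym L 1 np) (hn₁ : n₁ ∈ AdmissibleSym L 1 np) (ht0 : 0 ≤ t)
    (ht1 : t ≤ 1) :
    (fun x => √(n x ^ 2 + t * (n₁ x ^ 2 - n x ^ 2))) ∈ AdmissibleSym L 1 np := by
  have hb : ∀ x, 1 ≤ n x ^ 2 + t * (n₁ x ^ 2 - n x ^ 2) ∧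
      n x ^ 2 + t * (n₁ x ^ 2 - n x ^ 2) ≤ np ^ 2 := fun x => by
    obtain ⟨h1, h2⟩ := AdmissibleSym.bounds hnp hn x
    obtain ⟨h3, h4⟩ := AdmissibleSym.bounds hnp hn₁ x
    have h5 : 1 ≤ n x ^ 2 := by nlinarith
    have h6 : n x ^ 2 ≤ np ^ 2 := by nlinarith
    have h7 : 1 ≤ n₁ x ^ 2 := by nlinarith
    have h8 : n₁ x ^ 2 ≤ np ^ 2 := by nlinarith
    constructor <;> nlinarith
  refine ⟨?_, fun x _ => ⟨Real.one_le_sqrt.2 (hb x).1, ?_⟩, fun x hx => ?_, fun x => ?_⟩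
  · exact ((hn.1.pow_const 2).add (((hn₁.1.pow_const 2).sub (hn.1.pow_const 2)).const_mul t)).sqrt
  · exact Real.sqrt_le_iff.2 ⟨by linarith, (hb x).2⟩
  · simp [hn.2.2.1 x hx, hn₁.2.2.1 x hx]
  · simp only [hn.2.2.2 x, hn₁.2.2.2 x]

/-- With `s` the new index, `(s - n)(s + n) = t (n₁² - n²)` and `s + n ≥ 1`. -/
theorem eLpNorm_sqrt_interp_le {L np t : ℝ} {n n₁ : ℝ → ℝ} (hnp : 1 < np)
    (hn : n ∈ AdmissibleSym L 1 np) (hn₁ : n₁ ∈ AdmissibleSym L 1 np) (ht0 : 0 ≤ t)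
    (ht1 : t ≤ 1) :
    eLpNorm (fun x => √(n x ^ 2 + t * (n₁ x ^ 2 - n x ^ 2)) - n x) ⊤ volume ≤
      ENNReal.ofReal (t * np ^ 2) := by
  rw [eLpNorm_exponent_top]
  refine eLpNormEssSup_le_of_ae_bound (Eventually.of_forall fun x => ?_)
  obtain ⟨h1, h2⟩ := AdmissibleSym.bounds hnp hn x
  obtain ⟨h3, h4⟩ := AdmissibleSym.bounds hnp hn₁ x
  have hm := AdmissibleSym.bounds hnp (sqrt_interp_mem hnp hn hn₁ ht0 ht1) x
  set s := √(n x ^ 2 + t * (n₁ x ^ 2 - n x ^ 2)) with hs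
  have hsq : s ^ 2 = n x ^ 2 + t * (n₁ x ^ 2 - n x ^ 2) := by
    refine Real.sq_sqrt ?_
    nlinarith [sq_nonneg (n x), sq_nonneg (n₁ x)]
  rw [Real.norm_eq_abs]
  have hd : |n₁ x ^ 2 - n x ^ 2| ≤ np ^ 2 := by
    rw [abs_le]; constructor <;> nlinarith
  have h5 : |s - n x| * (s + n x) = t * |n₁ x ^ 2 - n x ^ 2| := by
    rw [← abs_of_nonneg ht0, ← abs_mul, ← abs_of_nonneg
      (show 0 ≤ s + n x by linarith), ← abs_mul]
    congr 1
    linear_combination hsq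
  have h6 : |s - n x| ≤ |s - n x| * (s + n x) :=
    le_mul_of_one_le_right (abs_nonneg _) (by linarith)
  rw [h5] at h6
  exact h6.trans (mul_le_mul_of_nonneg_left hd ht0)

theorem width_le_of_charFun {L np ρ : ℝ} (hL : 0 ≤ L) (hnp : 1 < np) {m : ℝ → ℝ}
    (hm : m ∈ AdmissibleSym L 1 np) {z : ℂ} (hz : z ≠ 0) (hzρ : |z.re| ≤ ρ) {ψ : ℝ → ℂ}
    (hψ : Continuous ψ)
    (heq : ∀ x ∈ Icc 0 L, ψ x = Complex.exp (-(Complex.I * z) * x) +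
      volterra z (fun y => (m y : ℂ) ^ 2 - 1) ψ x)
    (hamp : amplitude L z (fun y => (m y : ℂ) ^ 2 - 1) ψ = 1) :
    width L ρ m ≤ ENNReal.ofReal |z.im| :=
  iInf₂_le z ⟨exists_isResonancePair hL hnp hm hz hψ heq hamp, hzρ⟩

/-- First-order optimality: a local minimizer is bang-bang, with the two material values selected
by the sign of `Im (a u²)` for some nonzero constant `a`. -/
theorem exists_bangBang {L np ρ : ℝ} (hL : 0 < L) (hnp : 1 < np) {n : ℝ → ℝ}
    (hn : IsLocalMinimizer L 1 np ρ n) {ω : ℂ} {u : ℝ → ℂ} (hu : IsResonancePair L n ω u)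
    (hω : ENNReal.ofReal |ω.im| = width L ρ n) (hωρ : |ω.re| < ρ) (hω0 : 0 < |ω.re|)
    (him : ω.im < 0) (huL : u L ≠ 0) (hsym : ∀ x ∈ Icc 0 L, u (L - x) ^ 2 = u x ^ 2) :
    ∃ a : ℂ, a ≠ 0 ∧ ∀ᵐ x, x ∈ Icc 0 L →
      (0 < (a * u x ^ 2).im → n x = np) ∧ ((a * u x ^ 2).im < 0 → n x = 1) := by
  obtain ⟨hnA, ε₀, hε₀, hmin⟩ := hn
  have huc := hu.continuous hnp hnA
  have hωne := hu.ne_zero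
  set V : ℝ → ℂ := fun y => (n y : ℂ) ^ 2 - 1 with hVdef
  have hV : Measurable V := AdmissibleSym.measurable_contrast hnA
  have hVM : ∀ x, ‖V x‖ ≤ np ^ 2 := AdmissibleSym.norm_contrast_le hnp hnA
  -- The order of the zero and its cofactor `g ω` enter `a`, and `a` determines `n₁`; they are
  -- therefore read off first from the unperturbed problem `δ = 0`. `huniq` later shows that the
  -- perturbed family agrees with it at `t = 0`.
  obtain ⟨φ₀, F₀, hF₀d, -, hF₀, hφ₀, huniq⟩ := exists_charFun hL.le hV hVM
    (δ := fun _ => 0) measurable_const (fun x => by rw [norm_zero]; positivity)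
  have hV0 : ∀ δ : ℝ → ℂ, (fun y => V y + 0 * δ y) = V := fun δ => by funext y; ring
  set φ := IccExtend hL.le (φ₀ (ω, 0)) with hφdef
  have hφc : Continuous φ := continuous_IccExtend hL.le _
  set A := amplitude L ω V u with hA
  have huA : ∀ x ∈ Icc 0 L, u x = A * φ x :=
    huniq ω 0 A u huc fun x hx => by rw [hV0]; exact hu.eq_volterra hnp hnA hx
  have hA0 : A ≠ 0 := fun h => hu.not_eqOn_zero fun x hx => by rw [huA x hx, h, zero_mul]
  have hφa : amplitude L ω V φ = 1 := by
    have h1 : A = A * amplitude L ω V φ := by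
      rw [← amplitude_const_mul, hA]
      exact amplitude_congr hL.le _ _ huA
    exact (mul_left_cancel₀ hA0 (h1.symm.trans (mul_one A).symm))
  have hφe : ∀ x ∈ Icc 0 L, φ x = Complex.exp (-(Complex.I * ω) * x) + volterra ω V φ x := by
    have := hφ₀ ω 0
    rwa [hV0] at this
  set N := ∫ x in Icc 0 L, V x * (Complex.exp (-(Complex.I * ω) * x) * φ x) with hN
  have hN0 : N ≠ 0 := fun h => huL (by
    rw [huA L ⟨hL.le, le_rfl⟩, eq_integral_of_amplitude_eq_one hL.le hφe hφa, ← hN, h]; simp)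
  -- the order of the zero of the characteristic function
  set f : ℂ → ℂ := fun z => F₀ (z, 0) with hf
  have hfd : Differentiable ℂ f :=
    (hF₀d.differentiable one_ne_zero).comp (f := fun z : ℂ => (z, (0 : ℂ))) (by fun_prop)
  have hfω : f ω = 0 := by
    simp only [hf]
    rw [hF₀, hV0, ← hφdef, hφa, sub_self]
  have hf0 : f 0 = 1 := by
    simp only [hf]
    rw [hF₀]; simp [amplitude]
  -- The zero has finite order: `f` is entire and `f 0 = 1`, since the amplitude carries a factor
  -- `ω`.
  obtain ⟨m, g, hg, hgω, hfac⟩ := (hfd.analyticAt ω).exists_eventuallyEq_pow_smul_nonzero_iff.2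
    fun hev => by
      have := AnalyticOnNhd.eqOn_zero_of_preconnected_of_eventuallyEq_zero
        (fun z _ => hfd.analyticAt z) isPreconnected_univ (mem_univ ω) hev (mem_univ 0)
      rw [hf0] at this
      exact one_ne_zero this
  have hm : m ≠ 0 := by
    rintro rfl
    have := hfac.self_of_nhds
    rw [hfω] at this
    simp at this
    exact hgω this.symm
  -- This constant turns the displacement coefficient `-B / g ω` into `∫ δ (a u²)`.
  refine ⟨(A ^ 2 * N * g ω)⁻¹, inv_ne_zero (by simp [hA0, hN0, hgω]), ?_⟩
  set a := (A ^ 2 * N * g ω)⁻¹ with ha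
  set G : ℝ → ℝ := fun x => (a * u x ^ 2).im with hG
  have hGc : Continuous G := by fun_prop
  set n₁ : ℝ → ℝ := (Icc 0 L ∩ {x | 0 < G x}).indicator (fun _ => np - 1) + 1 with hn₁
  have hms : MeasurableSet (Icc 0 L ∩ {x | 0 < G x}) :=
    measurableSet_Icc.inter (isOpen_lt continuous_const hGc).measurableSet
  have hn₁pos : ∀ x, x ∈ Icc 0 L → 0 < G x → n₁ x = np := fun x h1 h2 => by
    simp only [hn₁, Pi.add_apply, Pi.one_apply]
    rw [indicator_of_mem (show x ∈ _ ∩ _ from ⟨h1, h2⟩)]; ring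
  have hn₁neg : ∀ x, ¬(x ∈ Icc 0 L ∧ 0 < G x) → n₁ x = 1 := fun x h => by
    simp only [hn₁, Pi.add_apply, Pi.one_apply]
    rw [indicator_of_notMem (show x ∉ _ ∩ _ from h)]; ring
  have hn₁A : n₁ ∈ AdmissibleSym L 1 np := by
    refine ⟨(measurable_const.indicator hms).add_const 1, fun x hx => ?_, fun x hx => ?_,
      fun x => ?_⟩
    · by_cases h : 0 < G x
      · rw [hn₁pos x hx h]; exact ⟨hnp.le, le_rfl⟩
      · rw [hn₁neg x fun h' => h h'.2]; exact ⟨le_rfl, hnp.le⟩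
    · exact hn₁neg x fun h => hx h.1
    · have hmem : L - x ∈ Icc 0 L ↔ x ∈ Icc 0 L := by
        simp only [mem_Icc]; constructor <;> rintro ⟨h1, h2⟩ <;> constructor <;> linarith
      by_cases hx : x ∈ Icc 0 L
      · have hGx : G (L - x) = G x := by simp only [hG, hsym x hx]
        by_cases h : 0 < G x
        · rw [hn₁pos x hx h, hn₁pos _ (hmem.2 hx) (hGx ▸ h)]
        · rw [hn₁neg x fun h' => h h'.2, hn₁neg _ fun h' => h (hGx ▸ h'.2)]
      · rw [hn₁neg x fun h => hx h.1, hn₁neg _ fun h => hx (hmem.1 h.1)]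
  set δ : ℝ → ℂ := fun x => ((n₁ x ^ 2 - n x ^ 2 : ℝ) : ℂ) with hδdef
  have hδ : Measurable δ :=
    Complex.measurable_ofReal.comp ((hn₁A.1.pow_const 2).sub (hnA.1.pow_const 2))
  have hδM : ∀ x, ‖δ x‖ ≤ np ^ 2 := fun x => by
    obtain ⟨h1, h2⟩ := AdmissibleSym.bounds hnp hnA x
    obtain ⟨h3, h4⟩ := AdmissibleSym.bounds hnp hn₁A x
    rw [hδdef, Complex.norm_real, Real.norm_eq_abs, abs_le]
    constructor <;> nlinarith
  obtain ⟨φ₁, F₁, hF₁d, hφ₁c, hF₁, hφ₁, -⟩ := exists_charFun hL.le hV hVM hδ hδM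
  have hφ₁₀ : ∀ z, ∀ x ∈ Icc 0 L, IccExtend hL.le (φ₁ (z, 0)) x =
      IccExtend hL.le (φ₀ (z, 0)) x := fun z x hx => by
    have h1 := hφ₁ z 0
    rw [hV0] at h1
    have := huniq z 0 1 _ (continuous_IccExtend hL.le (φ₁ (z, 0)))
      (fun y hy => by rw [hV0, one_mul]; exact h1 y hy) x hx
    rwa [one_mul] at this
  have hF₁₀ : ∀ z, F₁ (z, 0) = f z := fun z => by
    simp only [hf]
    rw [hF₁, hF₀, hV0, hV0, amplitude_congr hL.le _ _ (hφ₁₀ z)]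
  have hstrict : HasStrictFDerivAt F₁ (fderiv ℂ F₁ (ω, 0)) (ω, 0) :=
    hF₁d.contDiffAt.hasStrictFDerivAt one_ne_zero
  set B := fderiv ℂ F₁ (ω, 0) (0, 1) with hB
  have hBN : B * N = -∫ x in Icc 0 L, δ x * φ x ^ 2 := by
    have h1 := fderiv_charFun_mul hL.le hωne hV hVM hδ hδM hstrict.hasFDerivAt hφ₁c
      (hF₁ ω) (hφ₁ ω) ((hF₁₀ ω).trans hfω)
    rw [← hB] at h1
    rw [hN, setIntegral_congr_fun (g := fun x : ℝ => V x * (Complex.exp (-(Complex.I * ω) * x) *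
        IccExtend hL.le (φ₁ (ω, 0)) x)) measurableSet_Icc
        (fun x hx => by simp only [hφ₁₀ ω x hx, hφdef]), h1]
    congr 1
    exact setIntegral_congr_fun measurableSet_Icc (fun x hx => by simp only [hφ₁₀ ω x hx, hφdef])
  have hval : -B / g ω = ∫ x in Icc 0 L, δ x * (a * u x ^ 2) := by
    have h1 : ∫ x in Icc 0 L, δ x * (a * u x ^ 2) =
        a * A ^ 2 * ∫ x in Icc 0 L, δ x * φ x ^ 2 := by
      rw [← integral_const_mul]
      refine setIntegral_congr_fun measurableSet_Icc fun x hx => ?_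
      simp only [huA x hx]; ring
    rw [h1, ← neg_eq_iff_eq_neg.2 hBN, ha]
    field_simp
  have hint : IntegrableOn (fun x => δ x * (a * u x ^ 2)) (Icc 0 L) :=
    integrableOn_bounded_mul hδ hδM (by fun_prop)
  have himval : (-B / g ω).im = ∫ x in Icc 0 L, (n₁ x ^ 2 - n x ^ 2) * G x := by
    rw [hval]
    have h1 := Complex.imCLM.integral_comp_comm hint
    simp only [Complex.imCLM_apply] at h1
    rw [← h1]
    refine setIntegral_congr_fun measurableSet_Icc fun x _ => ?_
    simp only [hδdef, Complex.im_ofReal_mul, hG]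
  have hnn : ∀ x ∈ Icc 0 L, 0 ≤ (n₁ x ^ 2 - n x ^ 2) * G x := fun x hx => by
    obtain ⟨h1, h2⟩ := AdmissibleSym.bounds hnp hnA x
    by_cases h : 0 < G x
    · rw [hn₁pos x hx h]
      exact mul_nonneg (by nlinarith) h.le
    · rw [hn₁neg x fun h' => h h'.2]
      exact mul_nonneg_of_nonpos_of_nonpos (by nlinarith) (not_lt.1 h)
  have hle : (-B / g ω).im ≤ 0 := by
    by_contra! hpos
    -- In order, the bounds ensure `t ≤ 1`, `|z.re| ≤ ρ`, `z ≠ 0`, that `z` stays below the real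
    -- axis (so that rising decreases `|z.im|`), and that the competitor lies within `ε₀` of `n`.
    obtain ⟨ε, hε, hε1⟩ : ∃ ε > 0, ε ≤ 1 ∧ ε ≤ ρ - |ω.re| ∧ ε ≤ |ω.re| ∧ ε ≤ -ω.im ∧
        ε * np ^ 2 ≤ ε₀ := by
      refine ⟨min (min 1 (ρ - |ω.re|)) (min (min |ω.re| (-ω.im)) (ε₀ / np ^ 2)), ?_, ?_, ?_, ?_,
        ?_, ?_⟩
      · have : 0 < ε₀ / np ^ 2 := by positivity
        simp only [gt_iff_lt, lt_min_iff]
        refine ⟨⟨one_pos, by linarith⟩, ⟨hω0, by linarith⟩, this⟩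
      · exact (min_le_left _ _).trans (min_le_left _ _)
      · exact (min_le_left _ _).trans (min_le_right _ _)
      · exact (min_le_right _ _).trans ((min_le_left _ _).trans (min_le_left _ _))
      · exact (min_le_right _ _).trans ((min_le_left _ _).trans (min_le_right _ _))
      · rw [← le_div_iff₀ (by positivity)]
        exact (min_le_right _ _).trans (min_le_right _ _)
    obtain ⟨hεa, hεb, hεc, hεd, hεe⟩ := hε1
    obtain ⟨t, ht0, htε, z, hzω, hzim, hz0⟩ := exists_zero_of_perturbation
      (hF₁d.differentiable one_ne_zero) hstrict hg.continuousAt hgω hm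
      (hfac.mono fun z hz => by rw [hF₁₀, hz, smul_eq_mul]) hpos hε
    have hre : |z.re - ω.re| < ε := by
      have := (Complex.abs_re_le_norm (z - ω)).trans_lt hzω
      rwa [Complex.sub_re] at this
    have himz : |z.im - ω.im| < ε := by
      have := (Complex.abs_im_le_norm (z - ω)).trans_lt hzω
      rwa [Complex.sub_im] at this
    have hz : z ≠ 0 := by
      rintro rfl
      rw [Complex.zero_re, zero_sub, abs_neg] at hre
      linarith
    have hzρ : |z.re| ≤ ρ := by
      have := abs_sub_abs_le_abs_sub z.re ω.re
      linarith
    have htc : (fun y => ((√(n y ^ 2 + t * (n₁ y ^ 2 - n y ^ 2)) : ℝ) : ℂ) ^ 2 - 1) =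
        fun y => V y + (t : ℂ) * δ y := by
      funext y
      obtain ⟨h1, h2⟩ := AdmissibleSym.bounds hnp hnA y
      obtain ⟨h3, h4⟩ := AdmissibleSym.bounds hnp hn₁A y
      rw [← Complex.ofReal_pow, Real.sq_sqrt (by nlinarith [sq_nonneg (n y), sq_nonneg (n₁ y)])]
      simp only [hVdef, hδdef]
      push_cast
      ring
    have hmem := sqrt_interp_mem hnp hnA hn₁A ht0.le (htε.le.trans hεa)
    have hw := width_le_of_charFun (ρ := ρ) hL.le hnp hmem hz hzρ
      (continuous_IccExtend hL.le (φ₁ (z, t))) (by rw [htc]; exact hφ₁ z t)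
      (by rw [htc]; have := hF₁ z t; rw [hz0] at this; linear_combination this)
    have hlt : eLpNorm (fun x => √(n x ^ 2 + t * (n₁ x ^ 2 - n x ^ 2)) - n x) ⊤ volume <
        ENNReal.ofReal ε₀ := by
      refine (eLpNorm_sqrt_interp_le hnp hnA hn₁A ht0.le (htε.le.trans hεa)).trans_lt ?_
      rw [ENNReal.ofReal_lt_ofReal_iff hε₀]
      exact lt_of_lt_of_le (mul_lt_mul_of_pos_right htε (by positivity)) hεe
    have hcon := (hmin _ hmem hlt).trans hw
    rw [← hω, ENNReal.ofReal_le_ofReal_iff (abs_nonneg _), abs_of_neg him,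
      abs_of_nonpos (by linarith [(abs_lt.1 himz).2])] at hcon
    linarith
  rw [himval] at hle
  have hzero : ∫ x in Icc 0 L, (n₁ x ^ 2 - n x ^ 2) * G x = 0 :=
    le_antisymm hle (setIntegral_nonneg measurableSet_Icc hnn)
  have hint' : IntegrableOn (fun x => (n₁ x ^ 2 - n x ^ 2) * G x) (Icc 0 L) := by
    refine Integrable.congr (Integrable.im hint) (Eventually.of_forall fun x =>
      Complex.im_ofReal_mul _ _)
  rw [setIntegral_eq_zero_iff_of_nonneg_ae
    ((ae_restrict_mem measurableSet_Icc).mono hnn) hint'] at hzero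
  filter_upwards [(ae_restrict_iff' measurableSet_Icc).1 hzero] with x hx hxI
  have h0 : (n₁ x ^ 2 - n x ^ 2) * G x = 0 := hx hxI
  obtain ⟨h1, h2⟩ := AdmissibleSym.bounds hnp hnA x
  refine ⟨fun h => ?_, fun h => ?_⟩
  · have h3 := (mul_eq_zero.1 h0).resolve_right (ne_of_gt h)
    rw [hn₁pos x hxI h] at h3
    nlinarith
  · have h3 := (mul_eq_zero.1 h0).resolve_right (ne_of_lt h)
    rw [hn₁neg x fun h' => lt_asymm h h'.2] at h3
    nlinarith

/-! ### Helmholtz equation: unique continuation, flux, isolated zeros -/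

theorem IsPrimitive.intervalIntegrable_im {F f : ℝ → ℂ} (h : IsPrimitive F f) (a b : ℝ) :
    IntervalIntegrable (fun x => (f x).im) volume a b :=
  ⟨(h.intervalIntegrable a b).1.im, (h.intervalIntegrable a b).2.im⟩

theorem IsPrimitive.im_sub {F f : ℝ → ℂ} (h : IsPrimitive F f) (a b : ℝ) :
    (F b).im - (F a).im = ∫ x in a..b, (f x).im := by
  rw [← Complex.sub_im, h.sub_eq]
  exact (Complex.imCLM.intervalIntegral_comp_comm (h.intervalIntegrable a b)).symm

theorem IsPrimitive.re_sub {F f : ℝ → ℂ} (h : IsPrimitive F f) (a b : ℝ) :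
    (F b).re - (F a).re = ∫ x in a..b, (f x).re := by
  rw [← Complex.sub_re, h.sub_eq]
  exact (Complex.reCLM.intervalIntegral_comp_comm (h.intervalIntegrable a b)).symm

section Helmholtz

variable {n : ℝ → ℝ} {np : ℝ} {ω : ℂ} {u w : ℝ → ℂ}

/-- Backward uniqueness for the Helmholtz equation. -/
theorem eq_zero_of_eq_zero_of_deriv_eq_zero (hb : ∀ x, 1 ≤ n x ∧ n x ≤ np) (h1 : IsPrimitive u w)
    (h2 : IsPrimitive w (fun x => -ω ^ 2 * ((n x : ℂ) ^ 2 * u x))) {a c : ℝ} (hac : a ≤ c)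
    (hu : u c = 0) (hw : w c = 0) : u a = 0 := by
  -- Grönwall: with this `M` the function `(|u|² + |w|²) e^{Mx}` is nondecreasing, so vanishing at
  -- `c` propagates to the left.
  set M : ℝ := 1 + ‖ω‖ ^ 2 * np ^ 2 with hM
  have hE := ((h1.conj.mul h1).add (h2.conj.mul h2)).mul (isPrimitive_cexp M)
  have hexp : ∀ x : ℝ, Complex.exp ((M : ℂ) * x) = ((Real.exp (M * x) : ℝ) : ℂ) :=
    fun x => by push_cast; rfl
  have hpt : ∀ x, 0 ≤ ((starRingEnd ℂ (w x) * u x + starRingEnd ℂ (u x) * w x +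
      (starRingEnd ℂ (-ω ^ 2 * ((n x : ℂ) ^ 2 * u x)) * w x +
        starRingEnd ℂ (w x) * (-ω ^ 2 * ((n x : ℂ) ^ 2 * u x)))) * Complex.exp ((M : ℂ) * x) +
      (starRingEnd ℂ (u x) * u x + starRingEnd ℂ (w x) * w x) *
        (M * Complex.exp ((M : ℂ) * x))).re := fun x => by
    obtain ⟨hn1, hn2⟩ := hb x
    set z := -ω ^ 2 * ((n x : ℂ) ^ 2 * u x) with hz
    have e0 : (starRingEnd ℂ (w x) * u x + starRingEnd ℂ (u x) * w x +
      (starRingEnd ℂ z * w x + starRingEnd ℂ (w x) * z)) * Complex.exp ((M : ℂ) * x) +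
      (starRingEnd ℂ (u x) * u x + starRingEnd ℂ (w x) * w x) *
        (M * Complex.exp ((M : ℂ) * x)) =
        ((Real.exp (M * x) : ℝ) : ℂ) * ((starRingEnd ℂ (w x) * u x + starRingEnd ℂ (u x) * w x +
      (starRingEnd ℂ z * w x + starRingEnd ℂ (w x) * z)) +
        ((M : ℝ) : ℂ) * (starRingEnd ℂ (u x) * u x + starRingEnd ℂ (w x) * w x)) := by
      rw [hexp]; ring
    rw [e0, Complex.re_ofReal_mul]
    refine mul_nonneg (Real.exp_pos _).le ?_
    have hzn : ‖z‖ ≤ ‖ω‖ ^ 2 * np ^ 2 * ‖u x‖ := by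
      rw [hz, norm_mul, norm_mul, norm_neg, norm_pow, norm_pow, Complex.norm_real,
        Real.norm_eq_abs, abs_of_nonneg (by linarith), ← mul_assoc]
      gcongr
    have r1 : ∀ p q : ℂ, -(‖p‖ * ‖q‖) ≤ (starRingEnd ℂ p * q).re := fun p q => by
      have := (abs_le.1 (Complex.abs_re_le_norm (starRingEnd ℂ p * q))).1
      rwa [norm_mul, Complex.norm_conj] at this
    have r2 : ∀ p : ℂ, (starRingEnd ℂ p * p).re = ‖p‖ ^ 2 := fun p => by
      rw [← Complex.normSq_eq_norm_sq, ← Complex.normSq_eq_conj_mul_self, Complex.ofReal_re]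
    simp only [Complex.add_re, Complex.re_ofReal_mul, r2]
    have q1 := r1 (w x) (u x)
    have q2 := r1 (u x) (w x)
    have q3 := r1 z (w x)
    have q4 := r1 (w x) z
    have q5 : ‖w x‖ * ‖z‖ ≤ ‖w x‖ * (‖ω‖ ^ 2 * np ^ 2 * ‖u x‖) :=
      mul_le_mul_of_nonneg_left hzn (norm_nonneg _)
    have hc0 : 0 ≤ ‖ω‖ ^ 2 * np ^ 2 := by positivity
    have q6 := mul_nonneg (show 0 ≤ M by positivity) (sq_nonneg (‖u x‖ - ‖w x‖))
    rw [hM] at q6 ⊢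
    nlinarith
  have hre := hE.re_sub a c
  have hint : 0 ≤ ∫ x in a..c, ((starRingEnd ℂ (w x) * u x + starRingEnd ℂ (u x) * w x +
      (starRingEnd ℂ (-ω ^ 2 * ((n x : ℂ) ^ 2 * u x)) * w x +
        starRingEnd ℂ (w x) * (-ω ^ 2 * ((n x : ℂ) ^ 2 * u x)))) * Complex.exp ((M : ℂ) * x) +
      (starRingEnd ℂ (u x) * u x + starRingEnd ℂ (w x) * w x) *
        (M * Complex.exp ((M : ℂ) * x))).re :=
    intervalIntegral.integral_nonneg hac fun x _ => hpt x
  rw [← hre] at hint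
  simp only [hu, hw, mul_zero, add_zero, zero_mul, Complex.zero_re, zero_sub, hexp] at hint
  rw [← Complex.normSq_eq_conj_mul_self, ← Complex.normSq_eq_conj_mul_self, ← Complex.ofReal_add,
    ← Complex.ofReal_mul, Complex.ofReal_re] at hint
  have hp := Real.exp_pos (M * a)
  have h3 := Complex.normSq_nonneg (u a)
  have h4 := Complex.normSq_nonneg (w a)
  refine Complex.normSq_eq_zero.1 ?_
  nlinarith [mul_nonneg h3 hp.le, mul_nonneg h4 hp.le]

/-- The energy flux `Im (ū u')` of a solution. -/
theorem flux_sub (h1 : IsPrimitive u w)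
    (h2 : IsPrimitive w (fun x => -ω ^ 2 * ((n x : ℂ) ^ 2 * u x))) (a b : ℝ) :
    (starRingEnd ℂ (u b) * w b).im - (starRingEnd ℂ (u a) * w a).im =
      -(ω ^ 2).im * ∫ x in a..b, n x ^ 2 * ‖u x‖ ^ 2 := by
  rw [(h1.conj.mul h2).im_sub a b, ← intervalIntegral.integral_const_mul]
  refine intervalIntegral.integral_congr fun x _ => ?_
  have e : starRingEnd ℂ (w x) * w x + starRingEnd ℂ (u x) * (-ω ^ 2 * ((n x : ℂ) ^ 2 * u x)) =
      ((Complex.normSq (w x) : ℝ) : ℂ) - ((n x ^ 2 * ‖u x‖ ^ 2 : ℝ) : ℂ) * ω ^ 2 := by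
    rw [← Complex.normSq_eq_norm_sq]
    push_cast
    rw [Complex.normSq_eq_conj_mul_self, Complex.normSq_eq_conj_mul_self]
    ring
  simp only [e, Complex.sub_im, Complex.ofReal_im, Complex.im_ofReal_mul]
  ring

/-- If `u` vanished on `[a, b]`, its Cauchy data at the midpoint would vanish, and backward
uniqueness would give `u 0 = 0`. -/
theorem exists_ne_zero_of_lt (hb : ∀ x, 1 ≤ n x ∧ n x ≤ np) (h1 : IsPrimitive u w)
    (h2 : IsPrimitive w (fun x => -ω ^ 2 * ((n x : ℂ) ^ 2 * u x))) (hu0 : u 0 ≠ 0) {a b : ℝ}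
    (ha : 0 ≤ a) (hab : a < b) : ∃ c ∈ Icc a b, u c ≠ 0 := by
  by_contra! hz
  set c := (a + b) / 2 with hc
  have hcI : c ∈ Ioo a b := ⟨by linarith, by linarith⟩
  have hev : u =ᶠ[𝓝 c] fun _ => 0 := by
    filter_upwards [isOpen_Ioo.mem_nhds hcI] with x hx using hz x (Ioo_subset_Icc_self hx)
  have hw : w c = 0 :=
    (h1.hasDerivAt h2.continuous c).unique ((hasDerivAt_const c 0).congr_of_eventuallyEq hev)
  exact hu0 (eq_zero_of_eq_zero_of_deriv_eq_zero hb h1 h2 (ha.trans hcI.1.le)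
    (hz c (Ioo_subset_Icc_self hcI)) hw)

theorem intervalIntegrable_energy (hn : Measurable n) (hb : ∀ x, 1 ≤ n x ∧ n x ≤ np)
    (hu : Continuous u) (a b : ℝ) :
    IntervalIntegrable (fun x => n x ^ 2 * ‖u x‖ ^ 2) volume a b := by
  refine (Continuous.intervalIntegrable (u := fun x => np ^ 2 * ‖u x‖ ^ 2)
    (by fun_prop) a b).mono_fun
    ((hn.pow_const 2).mul (hu.norm.measurable.pow_const 2)).aestronglyMeasurable
    (Eventually.of_forall fun x => ?_)
  obtain ⟨h1, h2⟩ := hb x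
  have h3 : 0 ≤ n x ^ 2 * ‖u x‖ ^ 2 := by positivity
  have h4 : 0 ≤ np ^ 2 * ‖u x‖ ^ 2 := by positivity
  change ‖n x ^ 2 * ‖u x‖ ^ 2‖ ≤ ‖np ^ 2 * ‖u x‖ ^ 2‖
  rw [Real.norm_of_nonneg h3, Real.norm_of_nonneg h4]
  gcongr

theorem energy_pos (hn : Measurable n) (hb : ∀ x, 1 ≤ n x ∧ n x ≤ np) (h1 : IsPrimitive u w)
    (h2 : IsPrimitive w (fun x => -ω ^ 2 * ((n x : ℂ) ^ 2 * u x))) (hu0 : u 0 ≠ 0) {a b : ℝ}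
    (ha : 0 ≤ a) (hab : a < b) : 0 < ∫ x in a..b, n x ^ 2 * ‖u x‖ ^ 2 := by
  obtain ⟨c, hc, hcne⟩ := exists_ne_zero_of_lt hb h1 h2 hu0 ha hab
  have hcont : Continuous fun x => ‖u x‖ ^ 2 := by have := h1.continuous; fun_prop
  have hpos : 0 < ∫ x in a..b, ‖u x‖ ^ 2 :=
    intervalIntegral.integral_pos hab hcont.continuousOn (fun x _ => by positivity)
      ⟨c, hc, by positivity⟩
  refine hpos.trans_le (intervalIntegral.integral_mono_on hab.le (hcont.intervalIntegrable _ _)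
    (intervalIntegrable_energy hn hb h1.continuous a b) fun x _ => ?_)
  have := (hb x).1
  exact le_mul_of_one_le_left (by positivity) (by nlinarith)

/-- A continuous function without zeros has constant sign, and the weight is positive. -/
theorem integral_ne_zero_of_ne_zero {P : ℝ → ℝ} (hP : Continuous P) (hb : ∀ x, 1 ≤ n x)
    {a b : ℝ} (hab : a < b) (hint : IntervalIntegrable (fun x => n x ^ 2 * P x) volume a b)
    (hne : ∀ x ∈ Ioo a b, P x ≠ 0) : ∫ x in a..b, n x ^ 2 * P x ≠ 0 := by
  have hsign : (∀ x ∈ Ioo a b, 0 < P x) ∨ ∀ x ∈ Ioo a b, P x < 0 := by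
    by_contra! h
    obtain ⟨⟨x, hx, hPx⟩, y, hy, hPy⟩ := h
    obtain ⟨z, hz, hz0⟩ := isPreconnected_Ioo.intermediate_value hx hy hP.continuousOn
      ⟨hPx, hPy⟩
    exact hne z hz hz0
  have hn2 : ∀ x, 0 < n x ^ 2 := fun x => by have := hb x; positivity
  rcases hsign with h | h
  · exact (intervalIntegral.intervalIntegral_pos_of_pos_on hint
      (fun x hx => mul_pos (hn2 x) (h x hx)) hab).ne'
  · have h3 := intervalIntegral.intervalIntegral_pos_of_pos_on
      (f := fun x => -(n x ^ 2 * P x)) hint.neg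
      (fun x hx => neg_pos.2 (mul_neg_of_pos_of_neg (hn2 x) (h x hx))) hab
    rw [intervalIntegral.integral_neg] at h3
    linarith

/-- The zeros of the imaginary part of a nontrivial solution are isolated. -/
theorem finite_im_eq_zero (hb : ∀ x, 1 ≤ n x) (h1 : IsPrimitive u w)
    (h2 : IsPrimitive w (fun x => -ω ^ 2 * ((n x : ℂ) ^ 2 * u x))) (hω : (ω ^ 2).im ≠ 0) {L : ℝ}
    (hnd : ∀ x ∈ Icc 0 L, ¬(u x = 0 ∧ w x = 0)) : {x ∈ Icc 0 L | (u x).im = 0}.Finite := by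
  by_contra hinf
  obtain ⟨c, hc, hacc⟩ := Set.Infinite.exists_accPt_of_subset_isCompact hinf isCompact_Icc
    (sep_subset _ _)
  rw [accPt_iff_frequently_nhdsNE] at hacc
  refine hacc ?_
  have hd : ∀ x, HasDerivAt (fun x => (u x).im) (w x).im x := fun x =>
    (Complex.imCLM.hasFDerivAt.comp_hasDerivAt x (h1.hasDerivAt h2.continuous x))
  have hdP : ∀ x, HasDerivAt (fun x => (ω ^ 2 * u x).im) (ω ^ 2 * w x).im x := fun x =>
    (Complex.imCLM.hasFDerivAt.comp_hasDerivAt x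
      ((h1.hasDerivAt h2.continuous x).const_mul (ω ^ 2)))
  suffices ∀ᶠ x in 𝓝[≠] c, (u x).im ≠ 0 from this.mono fun x hx hx' => hx hx'.2
  by_cases hu : (u c).im = 0
  swap
  · exact nhdsWithin_le_nhds ((hd c).continuousAt.eventually_ne hu)
  by_cases hw : (w c).im = 0
  swap
  · exact (hd c).eventually_ne (c := 0) hw
  have hreal : ∀ z : ℂ, z.im = 0 → (ω ^ 2 * z).im = (ω ^ 2).im * z.re := fun z hz => by
    rw [Complex.mul_im, hz]; ring
  -- Remaining case: `u c` and `w c` are both real. They do not both vanish and `ω²` is not real, so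
  -- `Im (ω² u)`, which drives `(Im u)''`, is nonzero near `c` off `c`.
  have hP : ∀ᶠ x in 𝓝[≠] c, (ω ^ 2 * u x).im ≠ 0 := by
    by_cases hu0 : u c = 0
    · refine (hdP c).eventually_ne (c := 0) ?_
      rw [hreal _ hw]
      exact mul_ne_zero hω fun h => hnd c hc ⟨hu0, Complex.ext h hw⟩
    · refine nhdsWithin_le_nhds ((hdP c).continuousAt.eventually_ne ?_)
      rw [hreal _ hu]
      exact mul_ne_zero hω fun h => hu0 (Complex.ext h hu)
  have hPc : Continuous fun x => (ω ^ 2 * u x).im := by have := h1.continuous; fun_prop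
  have him : ∀ x, (-ω ^ 2 * ((n x : ℂ) ^ 2 * u x)).im = -(n x ^ 2 * (ω ^ 2 * u x).im) :=
    fun x => by
      have : -ω ^ 2 * ((n x : ℂ) ^ 2 * u x) = ((-n x ^ 2 : ℝ) : ℂ) * (ω ^ 2 * u x) := by
        push_cast; ring
      rw [this, Complex.im_ofReal_mul]; ring
  have hint : ∀ a b, IntervalIntegrable (fun x => n x ^ 2 * (ω ^ 2 * u x).im) volume a b :=
    fun a b => by
      have := (h2.intervalIntegrable_im a b).neg
      refine this.congr fun x _ => ?_
      rw [Pi.neg_apply, him, neg_neg]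
  have hwne : ∀ a b, a < b → (∀ x ∈ Ioo a b, (ω ^ 2 * u x).im ≠ 0) → (w a).im ≠ (w b).im :=
    fun a b hab hne heq => by
      have h3 := h2.im_sub a b
      simp only [him] at h3
      rw [intervalIntegral.integral_neg, heq, sub_self, eq_comm, neg_eq_zero] at h3
      exact integral_ne_zero_of_ne_zero hPc hb hab (hint a b) hne h3
  have hrolle : ∀ a b, a < b → (u a).im = 0 → (u b).im = 0 →
      ∃ ξ ∈ Ioo a b, (w ξ).im = 0 := fun a b hab ha hb' =>
    exists_hasDerivAt_eq_zero hab (HasDerivAt.continuousOn fun x _ => hd x) (ha.trans hb'.symm)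
      fun x _ => hd x
  obtain ⟨r, hr, hball⟩ := Metric.mem_nhdsWithin_iff.1 hP
  have hmem : ∀ x, x ≠ c → |x - c| < r → (ω ^ 2 * u x).im ≠ 0 := fun x hx hxr =>
    hball ⟨by rwa [Metric.mem_ball, Real.dist_eq], hx⟩
  -- A nearby zero `x` would give, by Rolle, a point `ξ` strictly between `x` and `c` with `Im w ξ =
  -- 0 = Im w c`, whereas `Im w` is strictly monotone on each side of `c`.
  filter_upwards [inter_mem_nhdsWithin {c}ᶜ (Metric.ball_mem_nhds c hr)] with x hx hux
  have hxr : |x - c| < r := by have := hx.2; rwa [Metric.mem_ball, Real.dist_eq] at this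
  rw [abs_lt] at hxr
  rcases lt_or_gt_of_ne (show x ≠ c from hx.1) with hlt | hlt
  · obtain ⟨ξ, hξ, hwξ⟩ := hrolle x c hlt hux hu
    refine hwne ξ c hξ.2 (fun y hy => hmem y hy.2.ne ?_) (hwξ.trans hw.symm)
    rw [abs_lt]; constructor <;> linarith [hy.1, hy.2, hξ.1]
  · obtain ⟨ξ, hξ, hwξ⟩ := hrolle c x hlt hu hux
    refine hwne c ξ hξ.1 (fun y hy => hmem y hy.1.ne' ?_) (hw.trans hwξ.symm)
    rw [abs_lt]; constructor <;> linarith [hy.1, hy.2, hξ.2]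

end Helmholtz

/-! ### Rotation of the phase -/

/-- Between two zeros of `Im (a u²)` the phase of `u` turns by at least `π / 2`, if the flux does
not vanish there. -/
theorem pi_div_two_mul_le {u w : ℝ → ℂ} (h1 : ∀ x, HasDerivAt u (w x) x) (hw : Continuous w)
    {α β C m : ℝ} (hαβ : α < β) (hu : ∀ x ∈ Icc α β, u x ≠ 0)
    (hJ : ∀ x ∈ Icc α β, (starRingEnd ℂ (u x) * w x).im ≠ 0)
    (hJC : ∀ x ∈ Icc α β, |(starRingEnd ℂ (u x) * w x).im| ≤ C) {a : ℂ} (ha : a ≠ 0)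
    (hα : (a * u α ^ 2).im = 0) (hβ : (a * u β ^ 2).im = 0) (hm : 0 < m)
    (hmu : ∀ x ∈ Icc α β, m ≤ ‖u x‖ ^ 2) : Real.pi / 2 * m ≤ (β - α) * C := by
  have huc : Continuous u := continuous_iff_continuousAt.2 fun x => (h1 x).continuousAt
  set h : ℝ → ℂ := IccExtend hαβ.le fun x : Icc α β => w x / u x with hh
  have hhc : Continuous h := by
    refine Continuous.Icc_extend' (Continuous.div ?_ ?_ fun x => hu x x.2)
    · exact hw.comp continuous_subtype_val
    · exact huc.comp continuous_subtype_val
  have hhe : ∀ x ∈ Icc α β, h x = w x / u x := fun x hx => IccExtend_of_mem hαβ.le _ hx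
  have him : ∀ x ∈ Icc α β, (h x).im = (starRingEnd ℂ (u x) * w x).im / ‖u x‖ ^ 2 :=
    fun x hx => by
      have hne := hu x hx
      have : w x / u x = ((‖u x‖ ^ 2)⁻¹ : ℝ) * (starRingEnd ℂ (u x) * w x) := by
        rw [← Complex.normSq_eq_norm_sq, Complex.ofReal_inv, Complex.normSq_eq_conj_mul_self]
        have : starRingEnd ℂ (u x) ≠ 0 := (map_ne_zero _).2 hne
        field_simp
      rw [hhe x hx, this, Complex.im_ofReal_mul, div_eq_inv_mul]
  -- A continuous logarithm of `u x / u α`; its imaginary part is the phase gained since `α`.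
  have hf : IsPrimitive (fun x => ∫ y in α..x, h y) h := IsPrimitive.integral hhc.locallyIntegrable α
  set f : ℝ → ℂ := fun x => ∫ y in α..x, h y with hfdef
  have hfd := hf.hasDerivAt hhc
  have hconst : u β * Complex.exp (-f β) = u α * Complex.exp (-f α) := by
    have hd : ∀ x, HasDerivAt (fun x => u x * Complex.exp (-f x))
        (w x * Complex.exp (-f x) + u x * (Complex.exp (-f x) * -h x)) x :=
      fun x => (h1 x).mul (hfd x).neg.cexp
    refine constant_of_has_deriv_right_zero (HasDerivAt.continuousOn fun x _ => hd x)
      (fun x hx => ?_) β (right_mem_Icc.2 hαβ.le)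
    have hx' : x ∈ Icc α β := Ico_subset_Icc_self hx
    have h3 := (hd x).hasDerivWithinAt (s := Ici x)
    rw [hhe x hx'] at h3
    have hne := hu x hx'
    convert h3 using 1
    field_simp
    ring
  have hfα : f α = 0 := intervalIntegral.integral_same
  have huβ : u β = u α * Complex.exp (f β) := by
    rw [hfα, neg_zero, Complex.exp_zero, mul_one] at hconst
    rw [← hconst, mul_assoc, ← Complex.exp_add]; simp
  have hre : ∀ z : ℂ, z.im = 0 → z = (z.re : ℂ) := fun z hz => Complex.ext rfl (by simp [hz])
  -- `a u(α)²` is real and nonzero, and `a u(β)²` is its multiple by `e^{2 f β}`; both being real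
  -- forces twice the phase gain into `π ℤ`. It is not `0`, since the phase velocity has constant
  -- sign.
  have hsin : Real.sin (2 * (f β).im) = 0 := by
    have e1 : a * u β ^ 2 = (a * u α ^ 2) * Complex.exp (2 * f β) := by
      rw [huβ, mul_pow, ← Complex.exp_nat_mul]; push_cast; ring
    rw [e1, hre _ hα, Complex.im_ofReal_mul, Complex.exp_im] at hβ
    have hne : (a * u α ^ 2).re ≠ 0 := fun h0 => by
      have : a * u α ^ 2 = 0 := by rw [hre _ hα, h0]; simp
      exact mul_ne_zero ha (pow_ne_zero 2 (hu α (left_mem_Icc.2 hαβ.le))) this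
    have h4 := (mul_eq_zero.1 ((mul_eq_zero.1 hβ).resolve_left hne)).resolve_left
      (Real.exp_pos _).ne'
    simpa using h4
  have hfim : (f β).im = ∫ y in α..β, (h y).im := by
    have := hf.im_sub α β
    rwa [hfα, Complex.zero_im, sub_zero] at this
  have hIm : Continuous fun y => (h y).im := Complex.continuous_im.comp hhc
  have hne : (f β).im ≠ 0 := by
    rw [hfim]
    have := integral_ne_zero_of_ne_zero (n := fun _ => 1) hIm (fun _ => le_rfl) hαβ
      (by simpa using hIm.intervalIntegrable α β) (fun x hx => by
        have hx' := Ioo_subset_Icc_self hx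
        rw [him x hx']
        exact div_ne_zero (hJ x hx') (pow_ne_zero 2 (norm_ne_zero_iff.2 (hu x hx'))))
    simpa using this
  obtain ⟨k, hk⟩ := Real.sin_eq_zero_iff.1 hsin
  have hk0 : k ≠ 0 := by
    rintro rfl
    simp at hk
    exact hne hk
  have hpi : Real.pi ≤ |2 * (f β).im| := by
    rw [← hk, abs_mul, abs_of_pos Real.pi_pos]
    have : (1 : ℝ) ≤ |(k : ℝ)| := by exact_mod_cast Int.one_le_abs hk0
    nlinarith [Real.pi_pos]
  have hbd : |(f β).im| ≤ C / m * |β - α| := by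
    rw [hfim, ← Real.norm_eq_abs]
    refine intervalIntegral.norm_integral_le_of_norm_le_const fun x hx => ?_
    rw [uIoc_of_le hαβ.le] at hx
    have hx' : x ∈ Icc α β := Ioc_subset_Icc_self hx
    rw [him x hx', Real.norm_eq_abs, abs_div, abs_of_nonneg (sq_nonneg ‖u x‖)]
    exact div_le_div₀ ((abs_nonneg _).trans (hJC x hx')) (hJC x hx') hm (hmu x hx')
  rw [abs_mul, abs_two] at hpi
  rw [abs_of_pos (sub_pos.2 hαβ)] at hbd
  have h5 : Real.pi / 2 ≤ C / m * (β - α) := by linarith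
  calc Real.pi / 2 * m ≤ C / m * (β - α) * m := mul_le_mul_of_nonneg_right h5 hm.le
    _ = (β - α) * C := by field_simp

/-! ### Symmetry and flux of resonance functions -/

namespace IsResonancePair

variable {L np : ℝ} {n : ℝ → ℝ} {ω : ℂ} {u w : ℝ → ℂ}

/-- If `u L = 0`, the outgoing condition gives `u' L = 0`, and backward uniqueness kills `u` on `[0,
L]`. -/
theorem apply_right_ne_zero (hnp : 1 < np) (hn : n ∈ AdmissibleSym L 1 np)
    (h : IsResonancePair L n ω u) : u L ≠ 0 := fun h0 => by
  obtain ⟨w, h1, h2, -, h4⟩ := h.exists_deriv hnp hn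
  rw [h0, mul_zero] at h4
  exact h.not_eqOn_zero fun x hx => eq_zero_of_eq_zero_of_deriv_eq_zero
    (AdmissibleSym.bounds hnp hn) h1 h2 hx.2 h0 h4

theorem apply_zero_ne_zero (hnp : 1 < np) (hn : n ∈ AdmissibleSym L 1 np)
    (h : IsResonancePair L n ω u) : u 0 ≠ 0 := by
  have := (h.reflect hnp hn).apply_right_ne_zero hnp hn
  simpa using this

/-- Resonance functions of a symmetric structure are even or odd about the center. -/
theorem apply_zero_mul (hnp : 1 < np) (hn : n ∈ AdmissibleSym L 1 np)
    (h : IsResonancePair L n ω u) {x : ℝ} (hx : x ≤ L) : u 0 * u x = u L * u (L - x) := by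
  obtain ⟨w, h1, h2, -, h4⟩ := h.exists_deriv hnp hn
  obtain ⟨w', h1', h2', -, h4'⟩ := (h.reflect hnp hn).exists_deriv hnp hn
  -- The combination `u 0 · u x - u L · u (L - x)` solves the same equation, and the outgoing
  -- conditions make its Cauchy data vanish at `L`.
  have k1 := (h1.const_mul (u 0)).add (h1'.const_mul (-u L))
  have k2 := ((h2.const_mul (u 0)).add (h2'.const_mul (-u L))).congr
    (g := fun x => -ω ^ 2 * ((n x : ℂ) ^ 2 * (u 0 * u x + -u L * u (L - x)))) (fun _ => rfl)
    fun x => by ring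
  have := eq_zero_of_eq_zero_of_deriv_eq_zero (AdmissibleSym.bounds hnp hn) k1 k2 hx
    (by simp only [sub_self]; ring) (by simp only [h4, h4', sub_self]; ring)
  linear_combination this

theorem apply_zero_sq (hL : 0 ≤ L) (hnp : 1 < np) (hn : n ∈ AdmissibleSym L 1 np)
    (h : IsResonancePair L n ω u) : u 0 ^ 2 = u L ^ 2 := by
  have := h.apply_zero_mul hnp hn hL
  rw [sub_zero] at this
  linear_combination this

theorem reflect_sq (hL : 0 ≤ L) (hnp : 1 < np) (hn : n ∈ AdmissibleSym L 1 np)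
    (h : IsResonancePair L n ω u) {x : ℝ} (hx : x ≤ L) : u (L - x) ^ 2 = u x ^ 2 := by
  have h1 := h.apply_zero_mul hnp hn hx
  have h2 := h.apply_zero_sq hL hnp hn
  refine mul_left_cancel₀ (pow_ne_zero 2 (h.apply_right_ne_zero hnp hn)) ?_
  linear_combination -(u 0 * u x + u L * u (L - x)) * h1 + u x ^ 2 * h2

theorem norm_apply_zero (hL : 0 ≤ L) (hnp : 1 < np) (hn : n ∈ AdmissibleSym L 1 np)
    (h : IsResonancePair L n ω u) : ‖u L‖ ^ 2 = ‖u 0‖ ^ 2 := by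
  rw [← norm_pow, ← norm_pow, h.apply_zero_sq hL hnp hn]

/-- An even `u` has zero derivative at the center and an odd `u` has zero value there; either kills
the flux. -/
theorem flux_center (hL : 0 < L) (hnp : 1 < np) (hn : n ∈ AdmissibleSym L 1 np)
    (h : IsResonancePair L n ω u) (hw : HasDerivAt u (w (L / 2)) (L / 2)) :
    (starRingEnd ℂ (u (L / 2)) * w (L / 2)).im = 0 := by
  have hc : L - L / 2 = L / 2 := by ring
  have h0 := h.apply_zero_ne_zero hnp hn
  have hd1 : HasDerivAt (fun x => u 0 * u x) (u 0 * w (L / 2)) (L / 2) := hw.const_mul _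
  have hd2 : HasDerivAt (fun x => u L * u (L - x)) (u L * -w (L / 2)) (L / 2) := by
    have h3 : HasDerivAt (fun x => u (L - x)) (-w (L / 2)) (L / 2) :=
      HasDerivAt.comp_const_sub L (L / 2) (by rwa [hc])
    exact h3.const_mul _
  have hev : (fun x => u 0 * u x) =ᶠ[𝓝 (L / 2)] fun x => u L * u (L - x) := by
    filter_upwards [Iio_mem_nhds (show L / 2 < L by linarith)] with x hx
    exact h.apply_zero_mul hnp hn (le_of_lt hx)
  have hw' := hd1.unique (hd2.congr_of_eventuallyEq hev)
  have hu' := h.apply_zero_mul hnp hn (show L / 2 ≤ L by linarith)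
  rw [hc] at hu'
  rcases sq_eq_sq_iff_eq_or_eq_neg.1 (h.apply_zero_sq hL.le hnp hn) with he | he
  · have : w (L / 2) = 0 := by
      refine mul_left_cancel₀ (mul_ne_zero two_ne_zero h0) ?_
      rw [← he] at hw'
      linear_combination hw'
    simp [this]
  · have : u (L / 2) = 0 := by
      refine mul_left_cancel₀ (mul_ne_zero two_ne_zero h0) ?_
      have he' : u L = -u 0 := by rw [he, neg_neg]
      rw [he'] at hu'
      linear_combination hu'
    simp [this]

theorem flux_left (h3 : w 0 = -(Complex.I * ω) * u 0) :
    (starRingEnd ℂ (u 0) * w 0).im = -ω.re * ‖u 0‖ ^ 2 := by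
  have : starRingEnd ℂ (u 0) * w 0 = ((‖u 0‖ ^ 2 : ℝ) : ℂ) * -(Complex.I * ω) := by
    rw [h3, ← Complex.normSq_eq_norm_sq, Complex.normSq_eq_conj_mul_self]; ring
  rw [this, Complex.im_ofReal_mul]; simp; ring

theorem flux_right (h4 : w L = Complex.I * ω * u L) :
    (starRingEnd ℂ (u L) * w L).im = ω.re * ‖u L‖ ^ 2 := by
  have : starRingEnd ℂ (u L) * w L = ((‖u L‖ ^ 2 : ℝ) : ℂ) * (Complex.I * ω) := by
    rw [h4, ← Complex.normSq_eq_norm_sq, Complex.normSq_eq_conj_mul_self]; ring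
  rw [this, Complex.im_ofReal_mul]; simp; ring

/-- Flux balance over `[0, L]` reads `|u 0|² = -Im ω ∫ n² |u|²`, with a positive integral. -/
theorem im_neg (hL : 0 < L) (hnp : 1 < np) (hn : n ∈ AdmissibleSym L 1 np)
    (h : IsResonancePair L n ω u) (hre : ω.re ≠ 0) : ω.im < 0 := by
  obtain ⟨w, h1, h2, h3, h4⟩ := h.exists_deriv hnp hn
  have h0 := h.apply_zero_ne_zero hnp hn
  have hE := energy_pos hn.1 (AdmissibleSym.bounds hnp hn) h1 h2 h0 le_rfl hL
  have hfl := flux_sub h1 h2 0 L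
  rw [flux_left h3, flux_right h4, h.norm_apply_zero hL.le hnp hn] at hfl
  have hsq : (ω ^ 2).im = 2 * ω.re * ω.im := by rw [sq, Complex.mul_im]; ring
  rw [hsq] at hfl
  have h5 : ‖u 0‖ ^ 2 = -ω.im * ∫ x in (0 : ℝ)..L, n x ^ 2 * ‖u x‖ ^ 2 := by
    refine mul_left_cancel₀ (mul_ne_zero two_ne_zero hre) ?_
    linear_combination hfl
  have h6 : 0 < ‖u 0‖ ^ 2 := by positivity
  rw [h5] at h6
  by_contra! hge
  nlinarith

/-- The flux is monotone between its end values `∓ Re ω |u 0|²`. -/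
theorem abs_flux_le (hL : 0 < L) (hnp : 1 < np) (hn : n ∈ AdmissibleSym L 1 np)
    (h : IsResonancePair L n ω u) (hre : ω.re ≠ 0) (h1 : IsPrimitive u w)
    (h2 : IsPrimitive w (fun x => -ω ^ 2 * ((n x : ℂ) ^ 2 * u x)))
    (h3 : w 0 = -(Complex.I * ω) * u 0) (h4 : w L = Complex.I * ω * u L) {x : ℝ}
    (hx : x ∈ Icc 0 L) : |(starRingEnd ℂ (u x) * w x).im| ≤ |ω.re| * ‖u 0‖ ^ 2 := by
  have him := h.im_neg hL hnp hn hre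
  have e1 := flux_sub h1 h2 0 x
  have e2 := flux_sub h1 h2 x L
  have p1 : 0 ≤ ∫ y in (0 : ℝ)..x, n y ^ 2 * ‖u y‖ ^ 2 :=
    intervalIntegral.integral_nonneg hx.1 fun y _ => by positivity
  have p2 : 0 ≤ ∫ y in x..L, n y ^ 2 * ‖u y‖ ^ 2 :=
    intervalIntegral.integral_nonneg hx.2 fun y _ => by positivity
  rw [flux_left h3] at e1
  rw [flux_right h4, h.norm_apply_zero hL.le hnp hn] at e2
  have hsq : (ω ^ 2).im = 2 * ω.re * ω.im := by rw [sq, Complex.mul_im]; ring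
  rw [hsq] at e1 e2
  set Q₁ := ∫ y in (0 : ℝ)..x, n y ^ 2 * ‖u y‖ ^ 2
  set Q₂ := ∫ y in x..L, n y ^ 2 * ‖u y‖ ^ 2
  have e3 : (starRingEnd ℂ (u x) * w x).im = ω.re * (-‖u 0‖ ^ 2 - 2 * ω.im * Q₁) := by
    linear_combination e1
  have e4 : -‖u 0‖ ^ 2 - 2 * ω.im * Q₁ = ‖u 0‖ ^ 2 + 2 * ω.im * Q₂ := by
    refine mul_left_cancel₀ hre ?_
    linear_combination -e1 - e2
  rw [e3, abs_mul]
  refine mul_le_mul_of_nonneg_left ?_ (abs_nonneg _)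
  rw [abs_le]
  constructor
  · nlinarith
  · rw [e4]; nlinarith

/-- The flux vanishes at the center and is strictly monotone. -/
theorem flux_ne_zero (hL : 0 < L) (hnp : 1 < np) (hn : n ∈ AdmissibleSym L 1 np)
    (h : IsResonancePair L n ω u) (hre : ω.re ≠ 0) (h1 : IsPrimitive u w)
    (h2 : IsPrimitive w (fun x => -ω ^ 2 * ((n x : ℂ) ^ 2 * u x))) {x : ℝ}
    (hx : 0 ≤ x) (hxc : x ≠ L / 2) : (starRingEnd ℂ (u x) * w x).im ≠ 0 := by
  have him := h.im_neg hL hnp hn hre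
  have hsq : (ω ^ 2).im ≠ 0 := by
    rw [sq, Complex.mul_im, mul_comm ω.im, ← two_mul]
    exact mul_ne_zero two_ne_zero (mul_ne_zero hre him.ne)
  have hc := h.flux_center hL hnp hn (h1.hasDerivAt h2.continuous (L / 2))
  have h0 := h.apply_zero_ne_zero hnp hn
  have hb := AdmissibleSym.bounds hnp hn
  intro hz
  rcases lt_or_gt_of_ne hxc with hlt | hlt
  · have e := flux_sub h1 h2 x (L / 2)
    rw [hc, hz, sub_self, eq_comm] at e
    exact mul_ne_zero (neg_ne_zero.2 hsq) (energy_pos hn.1 hb h1 h2 h0 hx hlt).ne' e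
  · have e := flux_sub h1 h2 (L / 2) x
    rw [hc, hz, sub_self, eq_comm] at e
    exact mul_ne_zero (neg_ne_zero.2 hsq)
      (energy_pos hn.1 hb h1 h2 h0 (by linarith) hlt).ne' e

/-- The function selecting the material has finitely many zeros. -/
theorem finite_im_mul_sq_eq_zero (hL : 0 < L) (hnp : 1 < np) (hn : n ∈ AdmissibleSym L 1 np)
    (h : IsResonancePair L n ω u) (hre : ω.re ≠ 0) {a : ℂ} (ha : a ≠ 0) :
    {x ∈ Icc 0 L | (a * u x ^ 2).im = 0}.Finite := by
  obtain ⟨w, h1, h2, -, -⟩ := h.exists_deriv hnp hn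
  have him := h.im_neg hL hnp hn hre
  have hsq : (ω ^ 2).im ≠ 0 := by
    rw [sq, Complex.mul_im, mul_comm ω.im, ← two_mul]
    exact mul_ne_zero two_ne_zero (mul_ne_zero hre him.ne)
  have hb := AdmissibleSym.bounds hnp hn
  have hfin : ∀ b : ℂ, b ≠ 0 → {x ∈ Icc 0 L | (b * u x).im = 0}.Finite := fun b hb0 => by
    refine finite_im_eq_zero (fun x => (hb x).1) (h1.const_mul b) ((h2.const_mul b).congr
      (fun _ => rfl) fun x => by ring) hsq fun x hx hz => ?_
    refine h.apply_zero_ne_zero hnp hn (eq_zero_of_eq_zero_of_deriv_eq_zero hb h1 h2 hx.1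
      ((mul_eq_zero.1 hz.1).resolve_left hb0) ((mul_eq_zero.1 hz.2).resolve_left hb0))
  -- With `b² = a`, `Im (a u²) = 2 Re (b u) Im (b u)`, and `Re (b u)` is the imaginary part of the
  -- solution `i b u`.
  obtain ⟨b, hb2⟩ := IsAlgClosed.exists_pow_nat_eq a two_pos
  have hb0 : b ≠ 0 := by rintro rfl; exact ha (by simpa using hb2.symm)
  refine ((hfin b hb0).union (hfin (Complex.I * b) (mul_ne_zero Complex.I_ne_zero hb0))).subset ?_
  rintro x ⟨hx, hx0⟩
  rw [← hb2, ← mul_pow, sq, Complex.mul_im] at hx0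
  have h5 : (b * u x).re * (b * u x).im = 0 := by linarith
  rcases mul_eq_zero.1 h5 with h6 | h6
  · refine Or.inr ⟨hx, ?_⟩
    rw [mul_assoc, Complex.I_mul_im]; exact h6
  · exact Or.inl ⟨hx, h6⟩

end IsResonancePair

/-! ### Transition points: uniqueness, reflection, vanishing of the selector -/

theorem exists_mem_of_ae {p : ℝ → Prop} (hp : ∀ᵐ y, p y) {a b : ℝ} (hab : a < b) :
    ∃ y ∈ Ioo a b, p y := by
  obtain ⟨y, hy, hpy⟩ := (Measure.dense_of_ae hp).exists_mem_open isOpen_Ioo (nonempty_Ioo.2 hab)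
  exact ⟨y, hpy, hy⟩

/-- The value of a step function at a point which has exactly `k` transition points on its left. -/
theorem stepIndex_of_count {np : ℝ} {N : ℕ} {x : ℕ → ℝ} (hN : Odd N) {k : ℕ} (hk : k ≤ N + 1)
    {t : ℝ} (hlt : ∀ j < k, x j < t) (hgt : ∀ j, k ≤ j → j ≤ N → t < x j) :
    stepIndex np N x t = if Odd k then np else 1 := by
  unfold stepIndex
  have hiff : (∃ j, j < N ∧ Even j ∧ t ∈ Ioo (x j) (x (j + 1))) ↔ Odd k := by
    constructor
    · rintro ⟨j, hj, hje, h1, h2⟩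
      have hjk : j < k := by
        by_contra! h
        exact lt_asymm h1 (hgt j h hj.le)
      have hjk' : k ≤ j + 1 := by
        by_contra! h
        exact lt_asymm h2 (hlt _ h)
      rw [show k = j + 1 by omega]
      exact hje.add_one
    -- `N + 1` is even, so an odd `k` is at most `N` and `x k` bounds `t` from the right.
    · intro hodd
      obtain ⟨i, hi⟩ := hodd
      obtain ⟨l, hl⟩ := hN
      refine ⟨2 * i, by omega, even_two_mul i, hlt _ (by omega), ?_⟩
      rw [← hi]
      exact hgt k le_rfl (by omega)
  simp only [hiff]

theorem IsTransitionSeq.ae_eq_of_count {L np : ℝ} {n : ℝ → ℝ} {N k : ℕ} {x : ℕ → ℝ}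
    (h : IsTransitionSeq L np n N x) (hk : k ≤ N + 1) {a b : ℝ}
    (hlt : ∀ j < k, x j ≤ a) (hgt : ∀ j, k ≤ j → j ≤ N → b ≤ x j) :
    ∀ᵐ t, t ∈ Ioo a b → n t = if Odd k then np else 1 := by
  filter_upwards [h.ae_eq] with t ht hmem
  rw [ht]
  exact stepIndex_of_count h.odd hk (fun j hj => (hlt j hj).trans_lt hmem.1)
    fun j hj hjN => hmem.2.trans_le (hgt j hj hjN)

theorem ite_odd_succ_ne {np : ℝ} (hnp : 1 < np) (k : ℕ) :
    (if Odd (k + 1) then np else 1) ≠ if Odd k then np else 1 := by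
  by_cases h : Odd k
  · simp [h, Nat.odd_add_one, hnp.ne]
  · simp [h, Nat.odd_add_one, hnp.ne']

/-- If `x k < y k`, then just to the right of `x k` one representation has passed `k + 1` points and
the other `k`, so they prescribe different values on an interval. -/
theorem IsTransitionSeq.le_of_forall_lt {L np : ℝ} (hnp : 1 < np) {n : ℝ → ℝ} {N : ℕ}
    {x y : ℕ → ℝ} (hx : IsTransitionSeq L np n N x) (hy : IsTransitionSeq L np n N y) {k : ℕ}
    (hk : k ≤ N) (h : ∀ j < k, x j = y j) : y k ≤ x k := by
  by_contra! hlt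
  set b := if k < N then min (x (k + 1)) (y k) else y k with hb
  have hby : b ≤ y k := by rw [hb]; split_ifs; exacts [min_le_right _ _, le_rfl]
  have hab : x k < b := by
    rw [hb]
    split_ifs with h'
    · exact lt_min (hx.strictMono (show k ≤ N from hk) (show k + 1 ≤ N from h')
        (Nat.lt_succ_self k)) hlt
    · exact hlt
  have h1 := hx.ae_eq_of_count (k := k + 1) (by omega) (a := x k) (b := b)
    (fun j hj => hx.strictMono.monotoneOn (show j ≤ N by omega) (show k ≤ N from hk)
      (Nat.lt_succ_iff.1 hj))
    (fun j hj hjN => by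
      have hkN : k < N := by omega
      refine le_trans ?_ (hx.strictMono.monotoneOn (show k + 1 ≤ N by omega)
        (show j ≤ N from hjN) hj)
      rw [hb, if_pos hkN]
      exact min_le_left _ _)
  have h2 := hy.ae_eq_of_count (k := k) (by omega) (a := x k) (b := b)
    (fun j hj => by
      rw [← h j hj]
      exact (hx.strictMono (show j ≤ N by omega) (show k ≤ N from hk) hj).le)
    (fun j hj hjN => hby.trans (hy.strictMono.monotoneOn (show k ≤ N from hk)
      (show j ≤ N from hjN) hj))
  obtain ⟨t, ht, h3, h4⟩ := exists_mem_of_ae (h1.and h2) hab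
  exact ite_odd_succ_ne hnp k ((h3 ht).symm.trans (h4 ht))

theorem IsTransitionSeq.unique {L np : ℝ} (hnp : 1 < np) {n : ℝ → ℝ} {N : ℕ}
    {x y : ℕ → ℝ} (hx : IsTransitionSeq L np n N x) (hy : IsTransitionSeq L np n N y) {k : ℕ}
    (hk : k ≤ N) : x k = y k := by
  induction k using Nat.strong_induction_on with
  | _ k ih =>
    have h : ∀ j < k, x j = y j := fun j hj => ih j hj (by omega)
    exact le_antisymm (hy.le_of_forall_lt hnp hx hk fun j hj => (h j hj).symm)
      (hx.le_of_forall_lt hnp hy hk h)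

/-- As `N` is odd, `j ↦ N - 1 - j` preserves parity, so reflection carries `np`-intervals to
`np`-intervals. -/
theorem IsTransitionSeq.reflect {L np : ℝ} {n : ℝ → ℝ} {N : ℕ} {x : ℕ → ℝ}
    (hx : IsTransitionSeq L np n N x) (hsym : ∀ t, n (L - t) = n t) :
    IsTransitionSeq L np n N (fun j => L - x (N - j)) := by
  refine ⟨hx.odd, fun i hi j hj hij => ?_, fun j hj => ?_, ?_⟩
  · have hi' : i ≤ N := hi
    have hj' : j ≤ N := hj
    have := hx.strictMono (show N - j ≤ N by omega) (show N - i ≤ N by omega)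
      (show N - j < N - i by omega)
    change L - x (N - i) < L - x (N - j)
    linarith
  · have := hx.mem (N - j) (by omega)
    exact ⟨by linarith [this.2], by linarith [this.1]⟩
  · have hmp : MeasurePreserving (fun t : ℝ => L - t) volume volume :=
      Measure.measurePreserving_sub_left volume L
    have h1 := hmp.quasiMeasurePreserving.ae_eq_comp hx.ae_eq
    filter_upwards [h1] with t ht
    simp only [Function.comp] at ht
    rw [← hsym, ht]
    unfold stepIndex
    obtain ⟨l, hl⟩ := hx.odd
    have hiff : (∃ j, j < N ∧ Even j ∧ L - t ∈ Ioo (x j) (x (j + 1))) ↔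
        ∃ j, j < N ∧ Even j ∧ t ∈ Ioo (L - x (N - j)) (L - x (N - (j + 1))) := by
      constructor
      · rintro ⟨j, hj, ⟨i, hi⟩, h2, h3⟩
        refine ⟨N - 1 - j, by omega, ⟨l - i, by omega⟩, ?_, ?_⟩
        · rw [show N - (N - 1 - j) = j + 1 by omega]; linarith
        · rw [show N - (N - 1 - j + 1) = j by omega]; linarith
      · rintro ⟨j, hj, ⟨i, hi⟩, h2, h3⟩
        refine ⟨N - (j + 1), by omega, ⟨l - i, by omega⟩, by linarith, ?_⟩
        rw [show N - (j + 1) + 1 = N - j by omega]; linarith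
    simp only [hiff]

/-- An interior interval does not contain the center. -/
theorem IsTransitionSeq.center_notMem {L np : ℝ} (hnp : 1 < np) {n : ℝ → ℝ} {N : ℕ} {x : ℕ → ℝ}
    (hx : IsTransitionSeq L np n N x) (hsym : ∀ t, n (L - t) = n t) {j : ℕ}
    (hj : IsInterior N j) : L / 2 ∉ Icc (x j) (x (j + 1)) := by
  rintro ⟨h1, h2⟩
  obtain ⟨hj0, hjN, hjc⟩ := hj
  obtain ⟨l, hl⟩ := hx.odd
  have e1 : x j = L - x (N - j) := hx.unique hnp (hx.reflect hsym) (by omega)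
  have e2 : x (j + 1) = L - x (N - (j + 1)) := hx.unique hnp (hx.reflect hsym) (by omega)
  have c1 : j ≤ N - j := by
    by_contra! h
    have := hx.strictMono (show N - j ≤ N by omega) (show j ≤ N by omega) h
    linarith
  have c2 : N - (j + 1) ≤ j + 1 := by
    by_contra! h
    have := hx.strictMono (show j + 1 ≤ N by omega) (show N - (j + 1) ≤ N by omega) h
    linarith
  -- `2 * j ≤ N ≤ 2 * j + 2` with `N` odd leaves only the excluded `N = 2 * j + 1`.
  omega

/-- At an inner transition point the function selecting the material vanishes. -/
theorem IsTransitionSeq.apply_eq_zero {L np : ℝ} (hnp : 1 < np) {n G : ℝ → ℝ} {N : ℕ}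
    {x : ℕ → ℝ} (hx : IsTransitionSeq L np n N x) (hG : Continuous G)
    (hsel : ∀ᵐ t, t ∈ Icc 0 L → (0 < G t → n t = np) ∧ (G t < 0 → n t = 1)) {j : ℕ}
    (hj0 : 0 < j) (hjN : j < N) : G (x j) = 0 := by
  obtain ⟨i, rfl⟩ : ∃ i, j = i + 1 := ⟨j - 1, by omega⟩
  have hl : x i < x (i + 1) := hx.strictMono (show i ≤ N by omega) (show i + 1 ≤ N by omega)
    (Nat.lt_succ_self i)
  have hr : x (i + 1) < x (i + 1 + 1) := hx.strictMono (show i + 1 ≤ N by omega)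
    (show i + 1 + 1 ≤ N by omega) (Nat.lt_succ_self _)
  have hL0 := (hx.mem i (by omega)).1
  have hLL := (hx.mem (i + 1 + 1) (by omega)).2
  have hcount : ∀ k, k + 1 ≤ N → ∀ᵐ t, t ∈ Ioo (x k) (x (k + 1)) →
      n t = if Odd (k + 1) then np else 1 := fun k hk =>
    hx.ae_eq_of_count (by omega)
      (fun m hm => hx.strictMono.monotoneOn (show m ≤ N by omega) (show k ≤ N by omega)
        (Nat.lt_succ_iff.1 hm))
      (fun m hm hmN => hx.strictMono.monotoneOn (show k + 1 ≤ N from hk) (show m ≤ N from hmN) hm)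
  -- If `G` were nonzero at the transition point, its constant sign nearby would select one value
  -- `v` on both sides, contradicting the jump. The two spare alternatives are excluded near that
  -- point, so one argument serves both signs.
  have key : ∀ v : ℝ, (∀ᵐ t, t ∈ Icc 0 L → t ∈ {t | n t = v} ∨ ¬ (0 < G t ∨ G t < 0) ∨
      (0 < G t ↔ ¬ 0 < G (x (i + 1)))) → G (x (i + 1)) ≠ 0 → False := fun v hv hne => by
    have hev : ∀ᶠ t in 𝓝 (x (i + 1)), (0 < G t ∨ G t < 0) ∧ (0 < G t ↔ 0 < G (x (i + 1))) := by
      rcases lt_or_gt_of_ne hne with h | h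
      · filter_upwards [hG.continuousAt.eventually_lt_const h] with t ht
        exact ⟨Or.inr ht, by constructor <;> intro h' <;> linarith⟩
      · filter_upwards [hG.continuousAt.eventually_const_lt h] with t ht
        exact ⟨Or.inl ht, by simp [ht, h]⟩
    obtain ⟨r, hr0, hball⟩ := Metric.eventually_nhds_iff.1 hev
    have hval : ∀ᵐ t, t ∈ Icc 0 L → |t - x (i + 1)| < r → n t = v := by
      filter_upwards [hv] with t ht htI htr
      obtain ⟨h3, h4⟩ := hball (y := t) (by rwa [Real.dist_eq])
      rcases ht htI with h5 | h5 | h5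
      · exact h5
      · exact absurd h3 h5
      · rw [h4] at h5; exact absurd h5 (by tauto)
    obtain ⟨t, ht, h6, h7⟩ := exists_mem_of_ae ((hcount i (by omega)).and hval)
      (max_lt hl (show x (i + 1) - r < x (i + 1) by linarith))
    obtain ⟨s, hs, h8, h9⟩ := exists_mem_of_ae ((hcount (i + 1) (by omega)).and hval)
      (lt_min hr (show x (i + 1) < x (i + 1) + r by linarith))
    have ht1 := max_lt_iff.1 ht.1
    have hs1 := lt_min_iff.1 hs.2
    have e1 := h7 ⟨by linarith, by linarith [ht.2]⟩ (by
      rw [abs_lt]; constructor <;> linarith [ht.2])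
    have e2 := h9 ⟨by linarith [hs.1], by linarith⟩ (by
      rw [abs_lt]; constructor <;> linarith [hs.1])
    rw [h6 ⟨ht1.1, ht.2⟩] at e1
    rw [h8 ⟨hs.1, hs1.1⟩] at e2
    exact ite_odd_succ_ne hnp (i + 1) (e2.trans e1.symm)
  by_contra hne
  by_cases hpos : 0 < G (x (i + 1))
  · refine key np ?_ hne
    filter_upwards [hsel] with t ht htI
    by_cases h : 0 < G t
    · exact Or.inl ((ht htI).1 h)
    · refine Or.inr (Or.inr ?_)
      simp [h, hpos]
  · refine key 1 ?_ hne
    filter_upwards [hsel] with t ht htI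
    by_cases h : G t < 0
    · exact Or.inl ((ht htI).2 h)
    · by_cases h' : 0 < G t
      · exact Or.inr (Or.inr (by simp [h', hpos]))
      · exact Or.inr (Or.inl (by tauto))

/-! ### Existence of the step representation -/

/-- A function which is almost everywhere `np` or almost everywhere `1` on each interval avoiding a
finite set is determined by the parity of the number of its jumps on the left. -/
theorem exists_transitions {np : ℝ} (hnp : 1 < np) {f : ℝ → ℝ} (h0 : ∀ᵐ y, y < 0 → f y = 1)
    (P : Finset ℝ) : ∀ B : ℝ, (∀ p ∈ P, p < B) →
      (∀ a b, a < b → b ≤ B → (∀ p ∈ P, p ∉ Ioo a b) →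
        (∀ᵐ y, y ∈ Ioo a b → f y = np) ∨ ∀ᵐ y, y ∈ Ioo a b → f y = 1) →
      ∃ (M : ℕ) (x : ℕ → ℝ), StrictMonoOn x (Iio M) ∧ (∀ j < M, x j ∈ P) ∧
        ∀ᵐ y, y < B → ∀ k ≤ M, (∀ j < k, x j < y) → (∀ j, k ≤ j → j < M → y < x j) →
          f y = if Odd k then np else 1 := by
  induction P using Finset.induction_on_max with
  | empty =>
    intro B _ hc
    refine ⟨0, fun _ => 0, fun i hi => absurd hi (Nat.not_lt_zero i),
      fun j hj => absurd hj (Nat.not_lt_zero j), ?_⟩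
    have hm0 := min_le_left (0 : ℝ) B
    have hmB := min_le_right (0 : ℝ) B
    have h1 : ∀ᵐ y, y ∈ Ioo (min 0 B - 1) B → f y = 1 := by
      refine (hc _ _ (by linarith) le_rfl (by simp)).resolve_left fun h => ?_
      obtain ⟨y, hy, h2, h3⟩ := exists_mem_of_ae (h.and h0)
        (show min 0 B - 1 < min 0 B by linarith)
      exact hnp.ne' ((h2 ⟨hy.1, hy.2.trans_le hmB⟩).symm.trans (h3 (hy.2.trans_le hm0)))
    filter_upwards [h0, h1] with y h2 h3 hyB k hk _ _
    obtain rfl : k = 0 := by omega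
    rw [if_neg (by simp)]
    rcases lt_or_ge (min 0 B - 1) y with h | h
    · exact h3 ⟨h, hyB⟩
    · exact h2 (by linarith)
  | insert p P hp ih =>
    intro B hB hc
    have hpB := hB p (Finset.mem_insert_self p P)
    obtain ⟨M, x, hx, hxP, hxf⟩ := ih p hp fun a b hab hb hP => by
      refine hc a b hab (hb.trans hpB.le) fun q hq => ?_
      rcases Finset.mem_insert.1 hq with rfl | hq
      · exact fun h => absurd h.2 (not_lt.2 hb)
      · exact hP q hq
    have hne : ∀ᵐ y : ℝ, y ≠ p := by simp [ae_iff, measure_singleton]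
    have hright := hc p B hpB le_rfl fun q hq h => by
      rcases Finset.mem_insert.1 hq with rfl | hq
      · exact lt_irrefl _ h.1
      · exact lt_asymm h.1 (hp q hq)
    -- Beyond the largest candidate `p`, either the parity persists and `p` is discarded, or it
    -- flips and `p` is appended.
    have hcase : (∀ᵐ y, y ∈ Ioo p B → f y = if Odd M then np else 1) ∨
        ∀ᵐ y, y ∈ Ioo p B → f y = if Odd (M + 1) then np else 1 := by
      by_cases hM : Odd M
      · simpa [hM, Nat.odd_add_one] using hright
      · simpa [hM, Nat.odd_add_one] using hright.symm
    rcases hcase with hr | hr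
    · refine ⟨M, x, hx, fun j hj => Finset.mem_insert_of_mem (hxP j hj), ?_⟩
      filter_upwards [hxf, hr, hne] with y h1 h2 h3 hyB k hk hlt hgt
      rcases lt_or_gt_of_ne h3 with h | h
      · exact h1 h k hk hlt hgt
      · obtain rfl : k = M := by
          by_contra hkM
          have hkM : k < M := by omega
          linarith [hgt k le_rfl hkM, hp _ (hxP k hkM)]
        exact h2 ⟨h, hyB⟩
    · have hlast : Function.update x M p M = p := Function.update_self ..
      have hold : ∀ j < M, Function.update x M p j = x j := fun j hj =>
        Function.update_of_ne hj.ne _ _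
      refine ⟨M + 1, Function.update x M p, fun i hi j hj hij => ?_, fun j hj => ?_, ?_⟩
      · have hi' : i < M + 1 := hi
        have hj' : j < M + 1 := hj
        rw [hold i (by omega)]
        rcases eq_or_ne j M with rfl | hjM
        · rw [hlast]; exact hp _ (hxP i hij)
        · rw [hold j (by omega)]
          exact hx (show i < M by omega) (show j < M by omega) hij
      · rcases eq_or_ne j M with rfl | hjM
        · rw [hlast]; exact Finset.mem_insert_self ..
        · rw [hold j (by omega)]
          exact Finset.mem_insert_of_mem (hxP j (by omega))
      · filter_upwards [hxf, hr, hne] with y h1 h2 h3 hyB k hk hlt hgt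
        rcases lt_or_gt_of_ne h3 with h | h
        · have hkM : k ≤ M := by
            by_contra! hkM
            have := hlt M hkM
            rw [hlast] at this
            linarith
          refine h1 h k hkM (fun j hj => ?_) fun j hj hjM => ?_
          · rw [← hold j (by omega)]; exact hlt j hj
          · rw [← hold j hjM]; exact hgt j hj (by omega)
        · obtain rfl : k = M + 1 := by
            by_contra hkM
            have h4 := hgt M (by omega) (by omega)
            rw [hlast] at h4
            linarith
          exact h2 ⟨h, hyB⟩

/-- A function on `[0, L]` which is selected by the sign of a continuous function with finitely
many zeros is a step function. -/
theorem exists_isTransitionSeq {L np : ℝ} (hL : 0 < L) (hnp : 1 < np) {n G : ℝ → ℝ}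
    (hout : ∀ x, x ∉ Icc 0 L → n x = 1) (hone : ¬ n =ᵐ[volume] fun _ => 1) (hG : Continuous G)
    (hfin : {x ∈ Icc 0 L | G x = 0}.Finite)
    (hsel : ∀ᵐ t, t ∈ Icc 0 L → (0 < G t → n t = np) ∧ (G t < 0 → n t = 1)) :
    ∃ (N : ℕ) (x : ℕ → ℝ), IsTransitionSeq L np n N x := by
  classical
  -- The ends are candidates too, since `n` may jump there to its outside value `1`.
  set P : Finset ℝ := hfin.toFinset ∪ {0, L} with hP
  have hPL : ∀ p ∈ P, p ∈ Icc 0 L := fun p hp => by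
    simp only [hP, Finset.mem_union, Finite.mem_toFinset, Finset.mem_insert,
      Finset.mem_singleton] at hp
    rcases hp with hp | rfl | rfl
    · exact hp.1
    · exact left_mem_Icc.2 hL.le
    · exact right_mem_Icc.2 hL.le
  obtain ⟨M, x, hx, hxP, hxf⟩ := exists_transitions (f := n) hnp
    (Eventually.of_forall fun y hy => hout y fun h => absurd h.1 (not_le.2 hy)) P (L + 1)
    (fun p hp => by linarith [(hPL p hp).2]) fun a b hab _ hav => by
      have ha0 : ¬ (a < 0 ∧ 0 < b) := hav 0 (by simp [hP])
      have haL : ¬ (a < L ∧ L < b) := hav L (by simp [hP])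
      rcases lt_or_ge a 0 with h | h
      · have hb : b ≤ 0 := not_lt.1 fun h' => ha0 ⟨h, h'⟩
        exact Or.inr (Eventually.of_forall fun y hy => hout y fun h' => by
          linarith [hy.2, h'.1])
      rcases lt_or_ge L b with h' | h'
      · have ha : L ≤ a := not_lt.1 fun h'' => haL ⟨h'', h'⟩
        exact Or.inr (Eventually.of_forall fun y hy => hout y fun h' => by
          linarith [hy.1, h'.2])
      have hsub : ∀ y ∈ Ioo a b, y ∈ Icc 0 L := fun y hy =>
        ⟨h.trans hy.1.le, hy.2.le.trans h'⟩
      have hsign : (∀ y ∈ Ioo a b, 0 < G y) ∨ ∀ y ∈ Ioo a b, G y < 0 := by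
        by_contra! hcon
        obtain ⟨⟨y, hy, hGy⟩, z, hz, hGz⟩ := hcon
        obtain ⟨t, ht, ht0⟩ := isPreconnected_Ioo.intermediate_value hy hz hG.continuousOn
          ⟨hGy, hGz⟩
        exact hav t (Finset.mem_union_left _ (hfin.mem_toFinset.2 ⟨hsub t ht, ht0⟩)) ht
      rcases hsign with hs | hs
      · left
        filter_upwards [hsel] with y hy hyI
        exact (hy (hsub y hyI)).1 (hs y hyI)
      · right
        filter_upwards [hsel] with y hy hyI
        exact (hy (hsub y hyI)).2 (hs y hyI)
  have hM0 : M ≠ 0 := by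
    rintro rfl
    refine hone ?_
    filter_upwards [hxf] with y hy
    rcases lt_or_ge y (L + 1) with h | h
    · simpa using hy h 0 le_rfl (fun j hj => absurd hj (Nat.not_lt_zero j)) (by simp)
    · exact hout y fun h' => by linarith [h'.2]
  -- To the right of `L` all `M` jumps have been passed and `n = 1`, so `M` is even. The last index
  -- `M - 1` is therefore odd.
  have hMe : ¬ Odd M := fun hodd => by
    obtain ⟨y, hy, h1⟩ := exists_mem_of_ae hxf (show L < L + 1 by linarith)
    have h2 := h1 hy.2 M le_rfl (fun j hj => (hPL _ (hxP j hj)).2.trans_lt hy.1)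
      fun j h3 h4 => absurd h3 (not_le.2 h4)
    rw [if_pos hodd, hout y fun h => absurd h.2 (not_le.2 hy.1)] at h2
    exact hnp.ne h2
  obtain ⟨l, hl⟩ := Nat.not_odd_iff_even.1 hMe
  have hNodd : Odd (M - 1) := ⟨l - 1, by omega⟩
  refine ⟨M - 1, x, hNodd, hx.mono fun j hj => ?_, fun j hj => hPL _ (hxP j (by omega)), ?_⟩
  · have : j ≤ M - 1 := hj
    exact show j < M by omega
  have hne : ∀ᵐ y : ℝ, ∀ j, y ≠ x j := ae_all_iff.2 fun j => by
    simp [ae_iff, measure_singleton]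
  filter_upwards [hxf, hne] with y h1 h2
  have hex : ∃ k, M ≤ k ∨ y ≤ x k := ⟨M, Or.inl le_rfl⟩
  -- The number of transition points to the left of `y`.
  set k := Nat.find hex with hk
  have hkM : k ≤ M := Nat.find_min' hex (Or.inl le_rfl)
  have hlt : ∀ j < k, x j < y := fun j hj => by
    have := Nat.find_min hex hj
    push Not at this
    exact this.2
  have hgt : ∀ j, k ≤ j → j < M → y < x j := fun j hj hjM => by
    have h3 : y ≤ x k := (Nat.find_spec hex).resolve_left (by omega)
    exact lt_of_le_of_ne (h3.trans (hx.monotoneOn (show k < M by omega) hjM hj)) (h2 j)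
  rw [stepIndex_of_count hNodd (by omega) hlt fun j hj hjN => hgt j hj (by omega)]
  rcases lt_or_ge y (L + 1) with h | h
  · exact h1 h k hkM hlt hgt
  · have hkM' : k = M := by
      by_contra hkM'
      have := hgt k le_rfl (by omega)
      linarith [(hPL _ (hxP k (by omega))).2]
    rw [hkM', if_neg hMe]
    exact hout y fun h' => by linarith [h'.2]

/-! ### Conclusion -/

/-- Without contrast the integral equation has no source; this guarantees that there is at least one
transition. -/
theorem IsResonancePair.not_ae_eq_one {L : ℝ} {n : ℝ → ℝ} {ω : ℂ} {u : ℝ → ℂ}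
    (h : IsResonancePair L n ω u) : ¬ n =ᵐ[volume] fun _ => 1 := fun hone => by
  refine h.nontrivial (funext fun x => ?_)
  rw [h.eq x, integral_eq_zero_of_ae]
  · simp
  · filter_upwards [ae_restrict_of_ae hone] with y hy
    simp [hy]

/-- An interval away from the center, between two zeros of `Im (a u²)`, is not too short. -/
theorem IsResonancePair.exists_isLeast_le {L np : ℝ} (hL : 0 < L) (hnp : 1 < np) {n : ℝ → ℝ}
    (hn : n ∈ AdmissibleSym L 1 np) {ω : ℂ} {u : ℝ → ℂ} (h : IsResonancePair L n ω u)
    (hre : ω.re ≠ 0) {a : ℂ} (ha : a ≠ 0) {α β : ℝ} (hαβ : α < β) (hα : α ∈ Icc 0 L)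
    (hβ : β ∈ Icc 0 L) (hc : L / 2 ∉ Icc α β) (hα0 : (a * u α ^ 2).im = 0)
    (hβ0 : (a * u β ^ 2).im = 0) :
    ∃ m : ℝ, IsLeast ((fun y => ‖u y‖ ^ 2) '' Icc α β) m ∧
      m / ‖u 0‖ ^ 2 * (1 / 4) * (2 * Real.pi / |ω.re|) ≤ |β - α| := by
  obtain ⟨w, h1, h2, h3, h4⟩ := h.exists_deriv hnp hn
  have hI : ∀ x ∈ Icc α β, x ∈ Icc 0 L := fun x hx =>
    ⟨hα.1.trans hx.1, hx.2.trans hβ.2⟩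
  have hJ : ∀ x ∈ Icc α β, (starRingEnd ℂ (u x) * w x).im ≠ 0 := fun x hx =>
    h.flux_ne_zero hL hnp hn hre h1 h2 (hI x hx).1 (by rintro rfl; exact hc hx)
  have hu : ∀ x ∈ Icc α β, u x ≠ 0 := fun x hx h0 => hJ x hx (by simp [h0])
  have huc : Continuous u := h.continuous hnp hn
  obtain ⟨t, ht, hmin⟩ := isCompact_Icc.exists_isMinOn (nonempty_Icc.2 hαβ.le)
    (f := fun y => ‖u y‖ ^ 2) (by fun_prop)
  refine ⟨‖u t‖ ^ 2, ⟨mem_image_of_mem _ ht, ?_⟩, ?_⟩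
  · rintro _ ⟨y, hy, rfl⟩
    exact hmin hy
  have hm : 0 < ‖u t‖ ^ 2 := pow_pos (norm_pos_iff.2 (hu t ht)) 2
  have key := pi_div_two_mul_le (fun x => h1.hasDerivAt h2.continuous x) h2.continuous hαβ hu hJ
    (fun x hx => h.abs_flux_le hL hnp hn hre h1 h2 h3 h4 (hI x hx)) ha hα0 hβ0 hm
    fun x hx => hmin hx
  have hu0 : 0 < ‖u 0‖ ^ 2 := pow_pos (norm_pos_iff.2 (h.apply_zero_ne_zero hnp hn)) 2
  have hr : 0 < |ω.re| := abs_pos.2 hre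
  rw [abs_of_pos (sub_pos.2 hαβ)]
  calc ‖u t‖ ^ 2 / ‖u 0‖ ^ 2 * (1 / 4) * (2 * Real.pi / |ω.re|)
      = Real.pi / 2 * ‖u t‖ ^ 2 / (|ω.re| * ‖u 0‖ ^ 2) := by field_simp; ring
    _ ≤ β - α := (div_le_iff₀ (mul_pos hr hu0)).2 key

end Resonance1D

theorem proposition6p6 (L np ρ : ℝ) (hL : 0 < L) (hnp : 1 < np)
    (n : ℝ → ℝ) (hn : Resonance1D.IsLocalMinimizer L 1 np ρ n)
    (ω : ℂ) (u : ℝ → ℂ) (hu : Resonance1D.IsResonancePair L n ω u)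
    (hω : ENNReal.ofReal |ω.im| = Resonance1D.width L ρ n)
    (hωρ : |ω.re| < ρ) (hω0 : 0 < |ω.re|) :
    u 0 ≠ 0 ∧
    (∃ (N : ℕ) (x : ℕ → ℝ), Resonance1D.IsTransitionSeq L np n N x) ∧
    ∀ (N : ℕ) (x : ℕ → ℝ), Resonance1D.IsTransitionSeq L np n N x →
      ∀ j, Resonance1D.IsInterior N j →
        ∃ m : ℝ, IsLeast ((fun y => ‖u y‖ ^ 2) '' Set.Icc (x j) (x (j + 1))) m ∧
          m / ‖u 0‖ ^ 2 * (1 / 4) * (2 * Real.pi / |ω.re|) ≤ |x (j + 1) - x j| := by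
  have hre : ω.re ≠ 0 := abs_pos.1 hω0
  have hnA := hn.1
  obtain ⟨a, ha, hsel⟩ := Resonance1D.exists_bangBang hL hnp hn hu hω hωρ hω0
    (hu.im_neg hL hnp hnA hre) (hu.apply_right_ne_zero hnp hnA)
    fun x hx => hu.reflect_sq hL.le hnp hnA hx.2
  have huc : Continuous u := hu.continuous hnp hnA
  have hG : Continuous fun x => (a * u x ^ 2).im :=
    Complex.continuous_im.comp (continuous_const.mul (huc.pow 2))
  refine ⟨hu.apply_zero_ne_zero hnp hnA, ?_, fun N x hx j hj => ?_⟩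
  · exact Resonance1D.exists_isTransitionSeq hL hnp hnA.2.2.1 hu.not_ae_eq_one hG
      (hu.finite_im_mul_sq_eq_zero hL hnp hnA hre ha) hsel
  · have hc := hx.center_notMem hnp hnA.2.2.2 hj
    -- Neither end of an interior interval is `x 0` or `x N`, which might be `0` or `L`, where `Im
    -- (a u²)` need not vanish.
    obtain ⟨hj0, hjN, -⟩ := hj
    exact hu.exists_isLeast_le hL hnp hnA hre ha
      (hx.strictMono (show j ≤ N by omega) (show j + 1 ≤ N by omega) (Nat.lt_succ_self j))
      (hx.mem j (by omega)) (hx.mem (j + 1) (by omega)) hc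
      (hx.apply_eq_zero hnp hG hsel hj0 (by omega))
      (hx.apply_eq_zero hnp hG hsel (Nat.succ_pos j) hjN)
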